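/- Let $\nu,\alpha,\beta>0$, and let $u_0,f\in H^1(\mathbb R^3;\mathbb R^3)$ be divergence free. For $g\in H^1(\mathbb R^3;\mathbb R^3)$ put $\|g\|^2_{\mathcal H^1_\alpha}=\|g\|^2_{L^2}+\alpha^2\|g\|^2_{\dot H^1}$, where $\|g\|_{\dot H^k}$ is the $L^2$ norm of the tensor of all $k$-th order derivatives of $g$. For $w\in L^2(\mathbb R^3)$ let $(w)_\alpha=(-\alpha^2\Delta+I)^{-1}w$, and let it act on tensors entry by entry. Let $(u,p)$, with $$u\in L^\infty([0,+\infty),H^1(\mathbb R^3))\cap L^2_{loc}([0,+\infty),\dot H^2(\mathbb R^3)),\qquad p\in L^2_{loc}([0,+\infty),H^3(\mathbb R^3)),$$ be a weak (distributional) solution of the damped Navier–Stokes–Bardina problem $$\partial_t u+\operatorname{div}\big((u\otimes u)_\alpha\big)-\nu\Delta u+\nabla p=f-\beta u,\qquad \operatorname{div}u=0,\qquad u(0,\cdot)=u_0 .$$ Then $u$ has a representative in time (again denoted by $u$) which is continuous from $[0,+\infty)$ to $L^2(\mathbb R^3)$, satisfies $u(0,\cdot)=u_0$, and is such that $u(t,\cdot)\in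 H^1(\mathbb R^3)$ is divergence free for every $t\ge 0$. This representative satisfies the following estimates. 1) For all $t\ge 0$: $$\|u(t,\cdot)\|^2_{\mathcal H^1_\alpha}\le \|u_0\|^2_{\mathcal H^1_\alpha}\,e^{-\beta t}+\frac{4}{\beta^2}\|f\|^2_{\mathcal H^1_\alpha}.$$ 2) For all $t\ge 0$ and $T\ge 0$: $$\nu\int_t^{t+T}\|u(s,\cdot)\|^2_{\dot H^1}\,ds+\nu\alpha^2\int_t^{t+T}\|u(s,\cdot)\|^2_{\dot H^2}\,ds\le \frac{2T}{\beta}\|f\|^2_{\mathcal H^1_\alpha}+\|u(t,\cdot)\|^2_{\mathcal H^1_\alpha},$$ where both integrals are finite. If moreover $\nu\ge \tfrac12$, the same inequality also holds with $\alpha^2$ in place of $\nu\alpha^2$ in front of the second integral. -/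

import Mathlib

open MeasureTheory Set
open scoped ContDiff

noncomputable section

namespace Bardina

/-- The physical space `ℝ³` with its Euclidean norm. -/
abbrev E3 : Type := EuclideanSpace ℝ (Fin 3)

/-- Real-valued `L²(ℝ³)`. -/
abbrev L2 : Type := Lp ℝ 2 (volume : Measure E3)

/-- Vector fields in `L²(ℝ³)³`, given by their three components. -/
abbrev VL2 : Type := Fin 3 → L2

/-- Classical partial derivative `∂ⱼ φ`. -/
def pd (j : Fin 3) (φ : E3 → ℝ) (x : E3) : ℝ :=
  fderiv ℝ φ x (EuclideanSpace.single j (1 : ℝ))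

/-- Classical Laplacian `Δ φ = ∑ⱼ ∂ⱼ ∂ⱼ φ`. -/
def lap (φ : E3 → ℝ) (x : E3) : ℝ := ∑ j : Fin 3, pd j (pd j φ) x

/-- Test functions `C_c^∞(ℝ³)`. -/
def IsTest (φ : E3 → ℝ) : Prop := ContDiff ℝ ∞ φ ∧ HasCompactSupport φ

/-- `h = ∂ⱼ g` in the sense of distributions, for `g, h ∈ L²(ℝ³)`. -/
def HasWeakPartial (j : Fin 3) (g h : L2) : Prop :=
  ∀ φ : E3 → ℝ, IsTest φ → ∫ x, g x * pd j φ x = -∫ x, h x * φ x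

open Classical in
/-- The weak partial derivative `∂ⱼ g`, and `0` if `g` has no weak derivative in `L²`. -/
def weakPartial (j : Fin 3) (g : L2) : L2 :=
  if h : ∃ d : L2, HasWeakPartial j g d then h.choose else 0

/-- Membership in the Sobolev space `H^k(ℝ³)`, `k ∈ ℕ`. -/
def MemSob : ℕ → L2 → Prop
  | 0, _ => True
  | k + 1, g => ∀ j : Fin 3, ∃ d : L2, HasWeakPartial j g d ∧ MemSob k d

/-- The homogeneous squared norm
`‖g‖²_{Ḣ^k} = ∑_{j₁, …, j_k} ‖∂_{j₁} ⋯ ∂_{j_k} g‖²_{L²}`, meaningful for `g ∈ H^k`. -/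
def homSq : ℕ → L2 → ℝ
  | 0, g => ‖g‖ ^ 2
  | k + 1, g => ∑ j : Fin 3, homSq k (weakPartial j g)

/-- Squared `Ḣ^k` norm of a vector field. -/
def vhomSq (k : ℕ) (u : VL2) : ℝ := ∑ i : Fin 3, homSq k (u i)

/-- `‖u‖²_{𝓗¹_α} = ‖u‖²_{L²} + α² ‖u‖²_{Ḣ¹}`. -/
def energySq (α : ℝ) (u : VL2) : ℝ := vhomSq 0 u + α ^ 2 * vhomSq 1 u

/-- `div u = 0` in the sense of distributions. -/
def IsDivFree (u : VL2) : Prop :=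
  ∀ φ : E3 → ℝ, IsTest φ → ∫ x, ∑ i : Fin 3, u i x * pd i φ x = 0

/-- Divergence-free vector fields in `H¹(ℝ³)`; this is the set underlying `𝓗¹_α(ℝ³)`. -/
def MemSolenoidalH1 (u : VL2) : Prop := (∀ i, MemSob 1 (u i)) ∧ IsDivFree u

/-- `w = (g)_α = (-α² Δ + I)⁻¹ g`: the function `w ∈ L²(ℝ³)` solves the Helmholtz equation
`-α² Δ w + w = g` in the sense of distributions. -/
def IsHelmholtzFilter (α : ℝ) (g : E3 → ℝ) (w : L2) : Prop :=
  ∀ φ : E3 → ℝ, IsTest φ →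
    ∫ x, w x * (φ x - α ^ 2 * lap φ x) = ∫ x, g x * φ x

/-- Lebesgue measure on the time interval `[0, +∞)`. -/
def timeMeasure : Measure ℝ := volume.restrict (Ici 0)

/-- `u ∈ L^∞([0,+∞), H¹) ∩ L²_loc([0,+∞), Ḣ²)`. -/
structure InEnergySpace (u : ℝ → VL2) : Prop where
  meas : AEStronglyMeasurable u timeMeasure
  memH1 : ∀ᵐ t ∂timeMeasure, ∀ i, MemSob 1 (u t i)
  bound : ∃ M : ℝ, ∀ᵐ t ∂timeMeasure, vhomSq 0 (u t) + vhomSq 1 (u t) ≤ M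
  memH2 : ∀ᵐ t ∂timeMeasure, ∀ i, MemSob 2 (u t i)
  sqInt : ∀ T : ℝ, IntegrableOn (fun t => vhomSq 2 (u t)) (Icc 0 T)

/-- `p ∈ L²_loc([0,+∞), H³)`. -/
structure InPressureSpace (p : ℝ → L2) : Prop where
  meas : AEStronglyMeasurable p timeMeasure
  memH3 : ∀ᵐ t ∂timeMeasure, MemSob 3 (p t)
  sqInt : ∀ T : ℝ, IntegrableOn (fun t => ∑ k ∈ Finset.range 4, homSq k (p t)) (Icc 0 T)

/-- `(u, p)` is a weak solution, in the energy space, of the damped Navier-Stokes-Bardina problem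
`∂ₜ u + div ((u ⊗ u)_α) - ν Δ u + ∇ p = f - β u`, `div u = 0`, `u(0, ·) = u₀`.
The equation and the initial condition are tested, component by component, against smooth
functions that are compactly supported in `[0, +∞) × ℝ³` (restrictions of elements of
`C_c^∞(ℝ × ℝ³)`). -/
structure IsWeakSolution (ν α β : ℝ) (f u₀ : VL2) (u : ℝ → VL2) (p : ℝ → L2) : Prop where
  energySpace : InEnergySpace u
  pressureSpace : InPressureSpace p
  divFree : ∀ᵐ t ∂timeMeasure, IsDivFree (u t)
  equation : ∃ w : ℝ → Fin 3 → Fin 3 → L2,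
    (∀ᵐ t ∂timeMeasure, ∀ i j,
      IsHelmholtzFilter α (fun x => u t i x * u t j x) (w t i j)) ∧
    ∀ (i : Fin 3) (φ : ℝ × E3 → ℝ), ContDiff ℝ ∞ φ → HasCompactSupport φ →
      (∫ t, (∫ x,
          (u t i x * deriv (fun s => φ (s, x)) t
            + ∑ j : Fin 3, w t i j x * pd j (fun y => φ (t, y)) x
            + ν * (u t i x * lap (fun y => φ (t, y)) x)
            + p t x * pd i (fun y => φ (t, y)) x
            + f i x * φ (t, x)
            - β * (u t i x * φ (t, x)))) ∂timeMeasure)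
        + ∫ x, u₀ i x * φ (0, x) = 0

/-- `v` is the representative of the time-a.e. class of `u` that is continuous on `[0, +∞)`
with values in `L²`; it gives `u(t, ·)` its meaning for every single `t ≥ 0`. -/
def IsContinuousVersion (u v : ℝ → VL2) : Prop :=
  ContinuousOn v (Ici 0) ∧ ∀ᵐ t ∂timeMeasure, v t = u t

end Bardina

end

/-! The squared norm `energySq α` is formally a Lyapunov function: testing the equation with
`(1 - α² Δ) u` gives `½ d/dt energySq α u = energyPower ν α β f u`. The nonlinear term drops out
because `1 - α² Δ` undoes the filter and leaves `∫ (u · ∇) u · u = 0`, the pressure term because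
`u` and `Δ u` are divergence free. Young's inequality absorbs the forcing into the damping, and
Gronwall's inequality gives both estimates.

For a weak solution the equation is first turned into an `L²`-valued evolution equation: by density
of the test functions `(1 - α² Δ) φ`, the velocity agrees almost everywhere with the primitive of
the right-hand side, which is the continuous representative. The representative is only `L²`-valued
and absolutely continuous, so the energy equality is proved for its mollification in space and then
passed to the limit, the mollified integrands being dominated by an integrable function. -/

noncomputable section

namespace Bardina

open Filter Topology

/-! ### Classical partial derivatives -/

section ClassicalDerivatives

variable {φ ψ : E3 → ℝ}

theorem pd_add (hφ : Differentiable ℝ φ) (hψ : Differentiable ℝ ψ) (j : Fin 3) :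
    pd j (φ + ψ) = pd j φ + pd j ψ := by
  ext x
  simp [pd, fderiv_add (hφ x) (hψ x)]

theorem pd_const_smul (hφ : Differentiable ℝ φ) (c : ℝ) (j : Fin 3) :
    pd j (c • φ) = c • pd j φ := by
  ext x
  simp [pd, fderiv_const_smul (hφ x)]

theorem pd_mul (hφ : Differentiable ℝ φ) (hψ : Differentiable ℝ ψ) (j : Fin 3) :
    pd j (φ * ψ) = φ * pd j ψ + ψ * pd j φ := by
  ext x
  simp [pd, fderiv_mul (hφ x) (hψ x)]

theorem pd_comm (hφ : ContDiff ℝ 2 φ) (j k : Fin 3) : pd j (pd k φ) = pd k (pd j φ) := by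
  have second_derivative (a b x : E3) :
      fderiv ℝ (fun y => fderiv ℝ φ y a) x b = fderiv ℝ (fderiv ℝ φ) x b a := by
    have hd : DifferentiableAt ℝ (fderiv ℝ φ) x :=
      (hφ.fderiv_right (m := 1) (by norm_num)).differentiable (by norm_num) x
    simp [fderiv_clm_apply hd (differentiableAt_const a)]
  ext x
  have hsymm : IsSymmSndFDerivAt ℝ φ x := hφ.contDiffAt.isSymmSndFDerivAt (by simp)
  exact (second_derivative ..).trans ((hsymm _ _).trans (second_derivative ..).symm)

theorem pd_comp_sub_right (φ : E3 → ℝ) (z : E3) (j : Fin 3) :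
    pd j (fun x => φ (x - z)) = fun x => pd j φ (x - z) := by
  ext x
  simp only [pd, fderiv_comp_sub]

theorem norm_fderiv_le_sum_abs_pd (φ : E3 → ℝ) (x : E3) :
    ‖fderiv ℝ φ x‖ ≤ ∑ j, |pd j φ x| := by
  refine ContinuousLinearMap.opNorm_le_bound _ (by positivity) fun v => ?_
  have hv : v = ∑ j, v j • EuclideanSpace.single j (1 : ℝ) := by
    ext i
    simp [Finset.sum_apply, Pi.single_apply]
  calc ‖fderiv ℝ φ x v‖ = ‖∑ j, v j * pd j φ x‖ := by
        conv_lhs => rw [hv]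
        simp only [map_sum, map_smul, smul_eq_mul, pd]
    _ ≤ ∑ j, ‖v j * pd j φ x‖ := norm_sum_le _ _
    _ ≤ ∑ j, |pd j φ x| * ‖v‖ := Finset.sum_le_sum fun j _ => by
        rw [norm_mul, mul_comm]
        exact mul_le_mul_of_nonneg_left (PiLp.norm_apply_le v j) (abs_nonneg _)
    _ = (∑ j, |pd j φ x|) * ‖v‖ := (Finset.sum_mul ..).symm

end ClassicalDerivatives

/-! ### Test functions -/

namespace IsTest

variable {φ ψ : E3 → ℝ}

theorem continuous (hφ : IsTest φ) : Continuous φ := hφ.1.continuous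

theorem differentiable (hφ : IsTest φ) : Differentiable ℝ φ := hφ.1.differentiable (by simp)

theorem memLp (hφ : IsTest φ) {p : ENNReal} : MemLp φ p (volume : Measure E3) :=
  hφ.continuous.memLp_of_hasCompactSupport hφ.2

theorem integrable (hφ : IsTest φ) : Integrable φ :=
  hφ.continuous.integrable_of_hasCompactSupport hφ.2

theorem pd (hφ : IsTest φ) (j : Fin 3) : IsTest (pd j φ) :=
  ⟨(hφ.1.fderiv_right (m := ∞) (by simp)).clm_apply contDiff_const, hφ.2.fderiv_apply ℝ _⟩

theorem mul (hφ : IsTest φ) (hψ : IsTest ψ) : IsTest (φ * ψ) :=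
  ⟨hφ.1.mul hψ.1, hφ.2.mul_right⟩

theorem comp_sub_right (hφ : IsTest φ) (z : E3) : IsTest (fun x => φ (x - z)) :=
  ⟨hφ.1.comp (contDiff_id.sub contDiff_const),
    hφ.2.comp_homeomorph (Homeomorph.subRight z)⟩

end IsTest

/-- The algebra `C_c^∞(ℝ³)` of test functions. -/
def testFunctions : NonUnitalSubalgebra ℝ (E3 → ℝ) where
  carrier := {φ | IsTest φ}
  zero_mem' := ⟨contDiff_const, .zero⟩
  add_mem' hφ hψ := ⟨hφ.1.add hψ.1, hφ.2.add hψ.2⟩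
  mul_mem' hφ hψ := hφ.mul hψ
  smul_mem' c _ hφ := ⟨contDiff_const.smul hφ.1, hφ.2.smul_left (f := fun _ => c)⟩

theorem isTest (φ : testFunctions) : IsTest (φ : E3 → ℝ) := φ.2

/-- The partial derivative `∂ⱼ` as a linear operator on test functions. -/
def testPd (j : Fin 3) : testFunctions →ₗ[ℝ] testFunctions where
  toFun φ := ⟨pd j φ, (isTest φ).pd j⟩
  map_add' φ ψ := Subtype.ext (pd_add (isTest φ).differentiable (isTest ψ).differentiable j)
  map_smul' c φ := Subtype.ext (pd_const_smul (isTest φ).differentiable c j)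

@[simp]
theorem coe_testPd (j : Fin 3) (φ : testFunctions) : (testPd j φ : E3 → ℝ) = pd j φ := rfl

theorem testPd_mul (j : Fin 3) (φ ψ : testFunctions) :
    testPd j (φ * ψ) = φ * testPd j ψ + ψ * testPd j φ :=
  Subtype.ext (pd_mul (isTest φ).differentiable (isTest ψ).differentiable j)

theorem testPd_comm (j k : Fin 3) (φ : testFunctions) :
    testPd j (testPd k φ) = testPd k (testPd j φ) :=
  Subtype.ext (pd_comm ((isTest φ).1.of_le (WithTop.coe_le_coe.2 le_top)) j k)

/-- The Laplacian as a linear operator on test functions. -/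
def testLap : testFunctions →ₗ[ℝ] testFunctions := ∑ j, testPd j ∘ₗ testPd j

theorem testLap_apply (φ : testFunctions) : testLap φ = ∑ j, testPd j (testPd j φ) := by
  simp [testLap]

theorem coe_testLap (φ : testFunctions) : (testLap φ : E3 → ℝ) = lap φ := by
  ext x
  simp [testLap_apply, lap]

theorem testLap_testPd (j : Fin 3) (φ : testFunctions) :
    testLap (testPd j φ) = testPd j (testLap φ) := by
  simp only [testLap_apply, map_sum]
  exact Finset.sum_congr rfl fun k _ => by rw [testPd_comm k j, testPd_comm k j]

/-! ### Pairing with test functions -/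

section PairingLp

variable {X : Type*} [MeasurableSpace X] {μ : Measure X}

theorem inner_eq_integral_mul (g h : Lp ℝ 2 μ) : inner ℝ g h = ∫ x, g x * h x ∂μ := by
  simp only [L2.inner_def, RCLike.inner_apply, conj_trivial, mul_comm]

theorem inner_toLp_right (g : Lp ℝ 2 μ) {φ : X → ℝ} (hφ : MemLp φ 2 μ) :
    inner ℝ g (hφ.toLp φ) = ∫ x, g x * φ x ∂μ := by
  rw [inner_eq_integral_mul]
  refine integral_congr_ae ?_
  filter_upwards [hφ.coeFn_toLp] with x hx
  rw [hx]

end PairingLp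

/-- The inclusion `C_c^∞(ℝ³) ⊆ L²(ℝ³)`. -/
def testToL2 : testFunctions →ₗ[ℝ] L2 where
  toFun φ := (isTest φ).memLp.toLp φ
  map_add' _ _ := rfl
  map_smul' _ _ := rfl

theorem coeFn_testToL2 (φ : testFunctions) : testToL2 φ =ᵐ[volume] (φ : E3 → ℝ) :=
  (isTest φ).memLp.coeFn_toLp

theorem inner_testToL2 (g : L2) (φ : testFunctions) :
    inner ℝ g (testToL2 φ) = ∫ x, g x * (φ : E3 → ℝ) x :=
  inner_toLp_right g (isTest φ).memLp

theorem inner_testToL2_testToL2 (φ ψ : testFunctions) :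
    inner ℝ (testToL2 φ) (testToL2 ψ) = ∫ x, (φ : E3 → ℝ) x * (ψ : E3 → ℝ) x := by
  rw [inner_testToL2]
  exact integral_congr_ae ((coeFn_testToL2 φ).mul .rfl)

theorem integrable_mul_test (g : L2) (φ : testFunctions) :
    Integrable fun x => g x * (φ : E3 → ℝ) x :=
  (Lp.memLp g).integrable_mul ((isTest φ).memLp (p := 2))

theorem denseRange_testToL2 : DenseRange testToL2 := by
  refine (Lp.dense_hasCompactSupport_contDiff (E := E3) (F := ℝ) (μ := volume)
    (p := 2) ENNReal.ofNat_ne_top).mono ?_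
  rintro f ⟨φ, hfφ, hsupp, hsmooth⟩
  exact ⟨⟨φ, hsmooth, hsupp⟩, Lp.ext ((coeFn_testToL2 _).trans hfφ.symm)⟩

/-! ### Weak derivatives -/

theorem hasWeakPartial_iff {j : Fin 3} {g h : L2} :
    HasWeakPartial j g h ↔
      ∀ φ, inner ℝ g (testToL2 (testPd j φ)) = -inner ℝ h (testToL2 φ) := by
  simp only [inner_testToL2, coe_testPd, Subtype.forall]
  rfl

namespace HasWeakPartial

variable {j : Fin 3} {g h d e : L2}

theorem unique (hd : HasWeakPartial j g d) (he : HasWeakPartial j g e) : d = e :=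
  denseRange_testToL2.eq_of_inner_left ℝ fun φ =>
    neg_injective <| (hasWeakPartial_iff.1 hd φ).symm.trans (hasWeakPartial_iff.1 he φ)

theorem weakPartial_eq (hd : HasWeakPartial j g d) : weakPartial j g = d := by
  have hex : ∃ d, HasWeakPartial j g d := ⟨d, hd⟩
  rw [weakPartial, dif_pos hex]
  exact hex.choose_spec.unique hd

theorem add (hg : HasWeakPartial j g d) (hh : HasWeakPartial j h e) :
    HasWeakPartial j (g + h) (d + e) := hasWeakPartial_iff.2 fun φ => by
  rw [inner_add_left, inner_add_left, hasWeakPartial_iff.1 hg, hasWeakPartial_iff.1 hh, neg_add]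

theorem const_smul (hg : HasWeakPartial j g d) (c : ℝ) :
    HasWeakPartial j (c • g) (c • d) := hasWeakPartial_iff.2 fun φ => by
  rw [real_inner_smul_left, real_inner_smul_left, hasWeakPartial_iff.1 hg, mul_neg]

end HasWeakPartial

theorem isClosed_setOf_hasWeakPartial (j : Fin 3) :
    IsClosed {q : L2 × L2 | HasWeakPartial j q.1 q.2} := by
  simp only [hasWeakPartial_iff, ofPred_forall]
  exact isClosed_iInter fun φ => isClosed_eq (by fun_prop) (by fun_prop)

theorem hasWeakPartial_testToL2 (j : Fin 3) (φ : testFunctions) :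
    HasWeakPartial j (testToL2 φ) (testToL2 (testPd j φ)) := hasWeakPartial_iff.2 fun ψ => by
  rw [inner_testToL2_testToL2, inner_testToL2_testToL2]
  exact integral_mul_fderiv_eq_neg_fderiv_mul_of_integrable
    (isTest (testPd j φ * ψ)).integrable (isTest (φ * testPd j ψ)).integrable
    (isTest (φ * ψ)).integrable (fun x _ => (isTest φ).differentiable x)
    (fun x _ => (isTest ψ).differentiable x)

/-! ### Translation and mollification in `L^p` -/

section Mollification

variable {E F : Type*} [NormedAddCommGroup E] [MeasurableSpace E] [BorelSpace E]
  {μ : Measure E} [μ.IsAddRightInvariant] [NormedAddCommGroup F] [NormedSpace ℝ F]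
  {p : ENNReal} [Fact (1 ≤ p)]

/-- The translate `x ↦ g (x - z)` of an element `g` of `L^p`. -/
def translate (z : E) : Lp F p μ →ₗᵢ[ℝ] Lp F p μ :=
  Lp.compMeasurePreservingₗᵢ ℝ (fun x => x - z) (measurePreserving_sub_right μ z)

theorem coeFn_translate (z : E) (g : Lp F p μ) : translate z g =ᵐ[μ] fun x => g (x - z) :=
  Lp.coeFn_compMeasurePreserving g (measurePreserving_sub_right μ z)

@[simp]
theorem translate_zero (g : Lp F p μ) : translate 0 g = g := by
  refine Lp.ext ?_
  filter_upwards [coeFn_translate 0 g] with x hx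
  rw [hx, sub_zero]

theorem inner_translate_left (z : E) (g h : Lp ℝ 2 μ) :
    inner ℝ (translate z g) h = inner ℝ g (translate (-z) h) := by
  rw [inner_eq_integral_mul, inner_eq_integral_mul,
    ← integral_sub_right_eq_self (fun x => g x * translate (-z) h x) z]
  have hshift : ∀ᵐ x ∂μ, translate (-z) h (x - z) = h x := by
    filter_upwards [(measurePreserving_sub_right μ z).quasiMeasurePreserving.ae
      (coeFn_translate (-z) h)] with x hx
    simpa using hx
  refine integral_congr_ae ?_
  filter_upwards [coeFn_translate z g, hshift] with x hg hh
  rw [hg, hh]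

variable [μ.InnerRegularCompactLTTop] [IsLocallyFiniteMeasure μ]

theorem continuous_translate (hp : p ≠ ⊤) (g : Lp F p μ) :
    Continuous fun z => translate z g :=
  continuous_const.compMeasurePreservingLp
    (g := fun z => ⟨fun x => x - z, continuous_id.sub continuous_const⟩)
    (ContinuousMap.continuous_of_continuous_uncurry _ (continuous_snd.sub continuous_fst))
    (measurePreserving_sub_right μ) hp

variable [SecondCountableTopology E] {k : E → ℝ}

theorem integrable_smul_translate (hk : Integrable k μ) (hp : p ≠ ⊤) (g : Lp F p μ) :
    Integrable (fun z => k z • translate z g) μ :=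
  hk.smul_bdd ‖g‖ (continuous_translate hp g).aestronglyMeasurable
    (Eventually.of_forall fun _ => (LinearIsometry.norm_map ..).le)

/-- The mollification `k ∗ g` of an element `g` of `L^p`, `p < ∞`, by an integrable kernel `k`,
as the Bochner integral of the translates of `g` against `k`. -/
def mollify (hk : Integrable k μ) (hp : p ≠ ⊤) : Lp F p μ →L[ℝ] Lp F p μ :=
  LinearMap.mkContinuous
    { toFun := fun g => ∫ z, k z • translate z g ∂μ
      map_add' := fun g h => by
        simp only [map_add, smul_add]
        exact integral_add (integrable_smul_translate hk hp g) (integrable_smul_translate hk hp h)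
      map_smul' := fun c g => by
        simp only [map_smul, RingHom.id_apply, ← integral_smul, smul_comm c] }
    (∫ z, |k z| ∂μ) fun g => by
      refine (norm_integral_le_integral_norm _).trans_eq ?_
      simp only [norm_smul, LinearIsometry.norm_map, Real.norm_eq_abs, integral_mul_const]

theorem mollify_apply (hk : Integrable k μ) (hp : p ≠ ⊤) (g : Lp F p μ) :
    mollify hk hp g = ∫ z, k z • translate z g ∂μ := rfl

theorem norm_mollify_le (hk : Integrable k μ) (hp : p ≠ ⊤) :
    ‖(mollify hk hp : Lp F p μ →L[ℝ] Lp F p μ)‖ ≤ ∫ z, |k z| ∂μ :=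
  LinearMap.mkContinuous_norm_le _ (by positivity) _

theorem inner_mollify_left (hk : Integrable k μ) (hp : (2 : ENNReal) ≠ ⊤) (g h : Lp ℝ 2 μ) :
    inner ℝ (mollify hk hp g) h = ∫ z, k z * inner ℝ (translate z g) h ∂μ := by
  rw [real_inner_comm, mollify_apply, ← integral_inner (integrable_smul_translate hk hp g)]
  simp only [real_inner_smul_right, real_inner_comm]

end Mollification

theorem tendsto_mollify {E F : Type*} [NormedAddCommGroup E] [NormedSpace ℝ E]
    [FiniteDimensional ℝ E] [MeasurableSpace E] [BorelSpace E] {μ : Measure E}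
    [μ.IsAddHaarMeasure] [NormedAddCommGroup F] [NormedSpace ℝ F] [CompleteSpace F] {p : ENNReal}
    [Fact (1 ≤ p)] (hp : p ≠ ⊤) {ι : Type*} {l : Filter ι} {b : ι → ContDiffBump (0 : E)}
    (hb : Tendsto (fun i => (b i).rOut) l (𝓝 0)) (g : Lp F p μ) :
    Tendsto (fun i => mollify (b i).integrable_normed hp g) l (𝓝 g) := by
  have h := ContDiffBump.convolution_tendsto_right_of_continuous (μ := μ) hb
    ((continuous_translate hp g).comp continuous_neg) 0
  simpa [convolution_def, mollify_apply] using h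

/-! ### Mollification by test functions -/

/-- The translate `x ↦ φ (x - z)` of a test function. -/
def testTranslate (z : E3) (φ : testFunctions) : testFunctions :=
  ⟨fun x => (φ : E3 → ℝ) (x - z), (isTest φ).comp_sub_right z⟩

theorem testPd_testTranslate (j : Fin 3) (z : E3) (φ : testFunctions) :
    testPd j (testTranslate z φ) = testTranslate z (testPd j φ) :=
  Subtype.ext (pd_comp_sub_right φ z j)

theorem translate_testToL2 (z : E3) (φ : testFunctions) :
    translate z (testToL2 φ) = testToL2 (testTranslate z φ) := by
  refine Lp.ext ?_
  filter_upwards [coeFn_translate z (testToL2 φ), coeFn_testToL2 (testTranslate z φ),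
    (measurePreserving_sub_right volume z).quasiMeasurePreserving.ae (coeFn_testToL2 φ)]
    with x h_left h_right h_shift
  rw [h_left, h_right, h_shift]
  rfl

theorem HasWeakPartial.translate {j : Fin 3} {g d : L2} (h : HasWeakPartial j g d) (z : E3) :
    HasWeakPartial j (translate z g) (translate z d) := hasWeakPartial_iff.2 fun φ => by
  rw [inner_translate_left, inner_translate_left, translate_testToL2, translate_testToL2,
    ← testPd_testTranslate]
  exact hasWeakPartial_iff.1 h _

/-- The convolution of two test functions. -/
def testConv (k φ : testFunctions) : testFunctions :=
  ⟨convolution k φ (ContinuousLinearMap.mul ℝ ℝ) volume,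
    (isTest φ).2.contDiff_convolution_right _ (isTest k).integrable.locallyIntegrable (isTest φ).1,
    HasCompactSupport.convolution _ (isTest k).2 (isTest φ).2⟩

theorem testConv_apply (k φ : testFunctions) (x : E3) :
    (testConv k φ : E3 → ℝ) x = ∫ z, (k : E3 → ℝ) z * (φ : E3 → ℝ) (x - z) := rfl

theorem testConv_comm (k φ : testFunctions) : testConv k φ = testConv φ k := by
  have hflip : (ContinuousLinearMap.mul ℝ ℝ).flip = ContinuousLinearMap.mul ℝ ℝ := by
    ext; simp
  refine Subtype.ext (Eq.trans ?_ (convolution_flip (ContinuousLinearMap.mul ℝ ℝ)))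
  rw [hflip]
  rfl

theorem testPd_testConv_right (j : Fin 3) (k φ : testFunctions) :
    testPd j (testConv k φ) = testConv k (testPd j φ) := by
  have hk : LocallyIntegrable (k : E3 → ℝ) := (isTest k).integrable.locallyIntegrable
  have hφ : ContDiff ℝ 1 (φ : E3 → ℝ) := (isTest φ).1.of_le (by simp)
  refine Subtype.ext (funext fun x => ?_)
  simp only [coe_testPd, testConv, pd]
  rw [((isTest φ).2.hasFDerivAt_convolution_right _ hk hφ x).fderiv,
    convolution_precompR_apply _ hk ((isTest φ).2.fderiv ℝ) (hφ.continuous_fderiv (by simp))]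
  rfl

theorem testPd_testConv_left (j : Fin 3) (k φ : testFunctions) :
    testPd j (testConv k φ) = testConv (testPd j k) φ := by
  rw [testConv_comm, testPd_testConv_right, testConv_comm]

/-- The mollification `k ∗ g` of `g ∈ L²(ℝ³)` by a test function `k`. -/
def testMollify (k : testFunctions) : L2 →L[ℝ] L2 :=
  mollify (isTest k).integrable ENNReal.ofNat_ne_top

theorem testMollify_testToL2 (k φ : testFunctions) :
    testMollify k (testToL2 φ) = testToL2 (testConv k φ) := by
  refine denseRange_testToL2.eq_of_inner_left ℝ fun χ => ?_
  rw [inner_testToL2_testToL2, testMollify, inner_mollify_left]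
  simp only [translate_testToL2, inner_testToL2_testToL2, testConv_apply, testTranslate,
    ← integral_const_mul, ← integral_mul_const]
  rw [integral_integral_swap_of_hasCompactSupport]
  · simp only [mul_assoc]
  · have := (isTest k).continuous
    have := (isTest φ).continuous
    have := (isTest χ).continuous
    unfold Function.uncurry
    fun_prop
  · refine HasCompactSupport.intro ((isTest k).2.isCompact.prod (isTest χ).2.isCompact) ?_
    rintro ⟨z, x⟩ hzx
    rcases not_and_or.1 (Set.mem_prod.not.1 hzx) with h | h <;>
      simp [Function.uncurry, image_eq_zero_of_notMem_tsupport h]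

theorem HasWeakPartial.testMollify {j : Fin 3} {g d : L2} (h : HasWeakPartial j g d)
    (k : testFunctions) : HasWeakPartial j (testMollify k g) (testMollify k d) :=
  hasWeakPartial_iff.2 fun φ => by
    simp only [Bardina.testMollify, inner_mollify_left, hasWeakPartial_iff.1 (h.translate _) φ,
      mul_neg, integral_neg]

theorem hasWeakPartial_testMollify (j : Fin 3) (k : testFunctions) (g : L2) :
    HasWeakPartial j (testMollify k g) (testMollify (testPd j k) g) := by
  refine denseRange_testToL2.induction_on g ?_ fun φ => ?_
  · exact (isClosed_setOf_hasWeakPartial j).preimage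
      (f := fun g : L2 => (testMollify k g, testMollify (testPd j k) g)) (by fun_prop)
  · rw [testMollify_testToL2, testMollify_testToL2, ← testPd_testConv_left]
    exact hasWeakPartial_testToL2 j _

theorem HasWeakPartial.testMollify_testPd {j : Fin 3} {g d : L2} (h : HasWeakPartial j g d)
    (k : testFunctions) : Bardina.testMollify (testPd j k) g = Bardina.testMollify k d :=
  (hasWeakPartial_testMollify j k g).unique (h.testMollify k)

/-- A smooth bump function around the origin, supported in the ball of radius `1 / (n + 1)`. -/
def mollifierBump (n : ℕ) : ContDiffBump (0 : E3) where
  rIn := 1 / (n + 2)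
  rOut := 1 / (n + 1)
  rIn_pos := by positivity
  rIn_lt_rOut := one_div_lt_one_div_of_lt (by positivity) (by linarith)

/-- The mollifying kernels `ρₙ`, an approximate identity. -/
def mollifierKernel (n : ℕ) : testFunctions :=
  ⟨(mollifierBump n).normed volume, (mollifierBump n).contDiff_normed,
    (mollifierBump n).hasCompactSupport_normed⟩

/-- The smoothing operators `g ↦ ρₙ ∗ g`. -/
def smooth (n : ℕ) : L2 →L[ℝ] L2 := testMollify (mollifierKernel n)

theorem norm_smooth_apply_le (n : ℕ) (g : L2) : ‖smooth n g‖ ≤ ‖g‖ := by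
  have hnorm : ‖smooth n‖ ≤ 1 := by
    refine (norm_mollify_le (p := 2) (isTest _).integrable ENNReal.ofNat_ne_top).trans_eq ?_
    simp only [mollifierKernel, abs_of_nonneg ((mollifierBump n).nonneg_normed _)]
    exact (mollifierBump n).integral_normed
  exact (smooth n).le_of_opNorm_le_of_le hnorm le_rfl |>.trans_eq (one_mul _)

theorem tendsto_smooth (g : L2) : Tendsto (fun n => smooth n g) atTop (𝓝 g) :=
  tendsto_mollify (b := mollifierBump) ENNReal.ofNat_ne_top
    (tendsto_one_div_add_atTop_nhds_zero_nat (𝕜 := ℝ)) g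

/-! ### Density of test functions -/

/-- Convolution commutes with the operators `D i`, so mollification approximates `g` together with
all the weak derivatives `D i g`. -/
theorem mem_closure_range_of_testMollify_eq {ι : Type*} {D : ι → testFunctions →ₗ[ℝ] testFunctions}
    (hD : ∀ i k φ, D i (testConv k φ) = testConv (D i k) φ) {g : L2} {e : ι → L2}
    (he : ∀ i k, testMollify (D i k) g = testMollify k (e i)) :
    (g, e) ∈ closure (range fun φ => (testToL2 φ, fun i => testToL2 (D i φ))) := by
  have mem_closure_mollified (n : ℕ) :
      (smooth n g, fun i => testMollify (D i (mollifierKernel n)) g) ∈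
        closure (range fun φ => (testToL2 φ, fun i => testToL2 (D i φ))) := by
    refine map_mem_closure (f := fun h => (smooth n h, fun i =>
      testMollify (D i (mollifierKernel n)) h)) (by fun_prop) (denseRange_testToL2 g) ?_
    rintro _ ⟨φ, rfl⟩
    exact ⟨testConv (mollifierKernel n) φ, by simp only [smooth, testMollify_testToL2, hD]⟩
  refine isClosed_closure.mem_of_tendsto (b := atTop) ?_
    (Eventually.of_forall mem_closure_mollified)
  simp only [he]
  exact (tendsto_smooth g).prodMk_nhds (tendsto_pi_nhds.2 fun i => tendsto_smooth (e i))

/-- The Sobolev space `H¹(ℝ³)`, realised as the space of pairs of a function and its weak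
gradient. -/
def H1 : Submodule ℝ (L2 × (Fin 3 → L2)) where
  carrier := {q | ∀ j, HasWeakPartial j q.1 (q.2 j)}
  zero_mem' j := by simpa using hasWeakPartial_testToL2 j 0
  add_mem' hq hr j := (hq j).add (hr j)
  smul_mem' c _ hq j := (hq j).const_smul c

theorem hasWeakPartial_H1 (q : H1) (j : Fin 3) : HasWeakPartial j q.1.1 (q.1.2 j) := q.2 j

/-- The inclusion `C_c^∞(ℝ³) ⊆ H¹(ℝ³)`. -/
def testToH1 (φ : testFunctions) : H1 :=
  ⟨(testToL2 φ, fun j => testToL2 (testPd j φ)), fun j => hasWeakPartial_testToL2 j φ⟩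

theorem denseRange_testToH1 : DenseRange testToH1 := fun q => by
  rw [closure_subtype, ← range_comp]
  exact mem_closure_range_of_testMollify_eq testPd_testConv_left
    fun j k => (hasWeakPartial_H1 q j).testMollify_testPd k

theorem HasWeakPartial.inner_eq_neg_inner {j : Fin 3} {g d h e : L2}
    (hg : HasWeakPartial j g d) (hh : HasWeakPartial j h e) :
    inner ℝ g e = -inner ℝ d h := by
  have hclosed : IsClosed {q : L2 × (Unit → L2) | inner ℝ g (q.2 ()) = -inner ℝ d q.1} :=
    isClosed_eq (by fun_prop) (by fun_prop)
  refine hclosed.closure_subset_iff.2 ?_ (mem_closure_range_of_testMollify_eq (ι := Unit)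
    (fun _ => testPd_testConv_left j) (g := h) (e := fun _ => e) fun _ k => hh.testMollify_testPd k)
  rintro _ ⟨φ, rfl⟩
  exact hasWeakPartial_iff.1 hg φ

/-! ### The Sobolev embedding and products of `H¹` functions -/

theorem eLpNorm_natCast_pow {X F : Type*} [MeasurableSpace X] {μ : Measure X}
    [NormedAddCommGroup F] (f : X → F) {n : ℕ} (hn : n ≠ 0) :
    eLpNorm f n μ ^ n = ∫⁻ x, ‖f x‖ₑ ^ n ∂μ := by
  have h := eLpNorm_nnreal_pow_eq_lintegral (f := f) (μ := μ) (p := n) (by exact_mod_cast hn)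
  simpa using h

theorem eLpNorm_four_pow_le {X F : Type*} [MeasurableSpace X] {μ : Measure X}
    [NormedAddCommGroup F] {f : X → F} (hf : AEStronglyMeasurable f μ) :
    eLpNorm f 4 μ ^ 4 ≤ eLpNorm f 2 μ * eLpNorm f 6 μ ^ 3 := by
  have holder := ENNReal.lintegral_mul_le_Lp_mul_Lq μ (p := 2) (q := 2)
    ⟨by norm_num, by norm_num, by norm_num⟩ hf.enorm (hf.enorm.pow_const 3)
  have h4 := eLpNorm_natCast_pow (μ := μ) f (n := 4) (by norm_num)
  have h2 := eLpNorm_natCast_pow (μ := μ) f (n := 2) (by norm_num)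
  have h6 := eLpNorm_natCast_pow (μ := μ) f (n := 6) (by norm_num)
  have sqrt_pow_six (a : ENNReal) : (a ^ 6) ^ (1 / 2 : ℝ) = a ^ 3 := by
    rw [← ENNReal.rpow_natCast, ← ENNReal.rpow_mul, ← ENNReal.rpow_natCast]
    norm_num
  have sqrt_pow_two (a : ENNReal) : (a ^ 2) ^ (1 / 2 : ℝ) = a := by
    rw [← ENNReal.rpow_natCast, ← ENNReal.rpow_mul]
    norm_num
  simp only [Nat.cast_ofNat] at h2 h4 h6
  simpa only [Pi.mul_apply, ← pow_succ', ENNReal.rpow_ofNat, ← pow_mul, ← h2, ← h6, ← h4,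
    Nat.reduceAdd, Nat.reduceMul, sqrt_pow_six, sqrt_pow_two] using holder

theorem lowerSemicontinuous_eLpNorm {X F : Type*} [MeasurableSpace X] {μ : Measure X}
    [NormedAddCommGroup F] {p : ENNReal} [Fact (1 ≤ p)] (q : ENNReal) :
    LowerSemicontinuous fun g : Lp F p μ => eLpNorm g q μ := by
  refine lowerSemicontinuous_iff_isClosed_preimage.2 fun C => ?_
  refine IsSeqClosed.isClosed fun g g₀ hg hlim => ?_
  obtain ⟨ns, -, hae⟩ := (tendstoInMeasure_of_tendsto_Lp hlim).exists_seq_tendsto_ae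
  exact Lp.eLpNorm_le_of_ae_tendsto (Eventually.of_forall fun n => hg (ns n))
    (fun n => Lp.aestronglyMeasurable _) hae

theorem enorm_fst_H1_le (q : H1) : ‖q.1.1‖ₑ ≤ ‖q‖ₑ :=
  enorm_le_iff_norm_le.2 (norm_fst_le q.1)

theorem enorm_snd_H1_le (q : H1) (j : Fin 3) : ‖q.1.2 j‖ₑ ≤ ‖q‖ₑ :=
  enorm_le_iff_norm_le.2 ((norm_le_pi_norm _ j).trans (norm_snd_le q.1))

theorem eLpNorm_fderiv_le (φ : testFunctions) :
    eLpNorm (fderiv ℝ (φ : E3 → ℝ)) 2 volume ≤ ∑ j, ‖testToL2 (testPd j φ)‖ₑ := by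
  calc eLpNorm (fderiv ℝ (φ : E3 → ℝ)) 2 volume
      ≤ eLpNorm (∑ j, fun x => |pd j φ x|) 2 volume := by
        refine eLpNorm_mono fun x => ?_
        rw [Finset.sum_apply, Real.norm_of_nonneg (by positivity)]
        exact norm_fderiv_le_sum_abs_pd φ x
    _ ≤ ∑ j, eLpNorm (fun x => |pd j φ x|) 2 volume :=
        eLpNorm_sum_le (fun j _ => ((isTest φ).pd j).continuous.abs.aestronglyMeasurable)
          one_le_two
    _ = ∑ j, ‖testToL2 (testPd j φ)‖ₑ := Finset.sum_congr rfl fun j _ => by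
        rw [Lp.enorm_def, eLpNorm_congr_ae (coeFn_testToL2 _), coe_testPd]
        exact eLpNorm_norm (pd j φ)

theorem exists_eLpNorm_six_testFunctions_le :
    ∃ C : NNReal, ∀ φ : testFunctions,
      eLpNorm (φ : E3 → ℝ) 6 volume ≤ C * eLpNorm (fderiv ℝ (φ : E3 → ℝ)) 2 volume :=
  ⟨_, fun φ => eLpNorm_le_eLpNorm_fderiv_of_eq_inner (volume : Measure E3)
    ((isTest φ).1.of_le (by simp)) (isTest φ).2 (p := 2) (p' := 6) (by norm_num) (by simp)
    (by simp; norm_num)⟩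

theorem exists_eLpNorm_six_le :
    ∃ C : NNReal, ∀ q : H1, eLpNorm q.1.1 6 volume ≤ C * ‖q‖ₑ := by
  obtain ⟨C, hC⟩ := exists_eLpNorm_six_testFunctions_le
  refine ⟨C * 3, fun q => ?_⟩
  have hcont : Continuous fun q : H1 => (q.1.1, ((C * 3 : NNReal) : ENNReal) * ‖q‖ₑ) :=
    (by fun_prop : Continuous fun q : H1 => q.1.1).prodMk
      ((ENNReal.continuous_const_mul ENNReal.coe_ne_top).comp continuous_enorm)
  refine denseRange_testToH1.induction_on q
    ((lowerSemicontinuous_eLpNorm 6).isClosed_epigraph.preimage hcont) fun φ => ?_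
  calc eLpNorm (testToL2 φ) 6 volume
      = eLpNorm (φ : E3 → ℝ) 6 volume := eLpNorm_congr_ae (coeFn_testToL2 φ)
    _ ≤ C * eLpNorm (fderiv ℝ (φ : E3 → ℝ)) 2 volume := hC φ
    _ ≤ C * ∑ j, ‖testToL2 (testPd j φ)‖ₑ := by gcongr; exact eLpNorm_fderiv_le φ
    _ ≤ C * ∑ _j : Fin 3, ‖testToH1 φ‖ₑ := by gcongr with j; exact enorm_snd_H1_le (testToH1 φ) j
    _ = (C * 3 : NNReal) * ‖testToH1 φ‖ₑ := by simp [mul_assoc]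

theorem exists_eLpNorm_four_le :
    ∃ C : NNReal, ∀ q : H1, eLpNorm q.1.1 4 volume ≤ C * ‖q‖ₑ := by
  obtain ⟨C, hC⟩ := exists_eLpNorm_six_le
  refine ⟨C + 1, fun q => (ENNReal.pow_le_pow_left_iff four_ne_zero).1 ?_⟩
  calc eLpNorm q.1.1 4 volume ^ 4
      ≤ eLpNorm q.1.1 2 volume * eLpNorm q.1.1 6 volume ^ 3 :=
        eLpNorm_four_pow_le (Lp.aestronglyMeasurable _)
    _ ≤ ((C + 1 : NNReal) * ‖q‖ₑ) * ((C + 1 : NNReal) * ‖q‖ₑ) ^ 3 := by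
        push_cast
        gcongr
        · rw [← Lp.enorm_def]
          exact (enorm_fst_H1_le q).trans (le_mul_of_one_le_left' le_add_self)
        · exact (hC q).trans (by gcongr; exact le_self_add)
    _ = ((C + 1 : NNReal) * ‖q‖ₑ) ^ 4 := by ring

theorem memLp_four_H1 (q : H1) : MemLp q.1.1 4 volume := by
  obtain ⟨C, hC⟩ := exists_eLpNorm_four_le
  exact ⟨Lp.aestronglyMeasurable _, (hC q).trans_lt (ENNReal.mul_lt_top (by simp) (by simp))⟩

instance fact_one_le_four : Fact ((1 : ENNReal) ≤ 4) := ⟨by norm_num⟩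

/-- The embedding `H¹(ℝ³) ⊆ L⁴(ℝ³)`. -/
def sobolevEmbedding : H1 →L[ℝ] Lp ℝ 4 (volume : Measure E3) :=
  LinearMap.mkContinuousOfExistsBound
    { toFun := fun q => (memLp_four_H1 q).toLp q.1.1
      map_add' := fun q r => by
        rw [← MemLp.toLp_add]
        exact MemLp.toLp_congr _ _ (Lp.coeFn_add q.1.1 r.1.1)
      map_smul' := fun c q => by
        rw [RingHom.id_apply, ← MemLp.toLp_const_smul]
        exact MemLp.toLp_congr _ _ (Lp.coeFn_smul c q.1.1) } <| by
    obtain ⟨C, hC⟩ := exists_eLpNorm_four_le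
    refine ⟨C, fun q => (Lp.norm_toLp _ (memLp_four_H1 q)).trans_le ?_⟩
    refine ENNReal.toReal_le_of_le_ofReal (by positivity) ?_
    rw [ENNReal.ofReal_mul C.coe_nonneg, ENNReal.ofReal_coe_nnreal, ofReal_norm]
    exact hC q

theorem coeFn_sobolevEmbedding (q : H1) : sobolevEmbedding q =ᵐ[volume] q.1.1 :=
  (memLp_four_H1 q).coeFn_toLp

instance holderTriple_four_four_two : ENNReal.HolderTriple 4 4 2 :=
  ⟨by
    rw [← ENNReal.toReal_eq_toReal_iff' (by simp) (by simp), ENNReal.toReal_add (by simp) (by simp)]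
    norm_num⟩

/-- The pointwise product of two functions in `H¹(ℝ³)`, as a continuous bilinear map into
`L²(ℝ³)`. -/
def mulH1 : H1 →L[ℝ] H1 →L[ℝ] L2 :=
  ((ContinuousLinearMap.mul ℝ ℝ).holderL volume 4 4 2).bilinearComp
    sobolevEmbedding sobolevEmbedding

theorem coeFn_mulH1 (q r : H1) : mulH1 q r =ᵐ[volume] fun x => q.1.1 x * r.1.1 x := by
  filter_upwards [(ContinuousLinearMap.mul ℝ ℝ).coeFn_holder (r := 2) (sobolevEmbedding q)
    (sobolevEmbedding r), coeFn_sobolevEmbedding q, coeFn_sobolevEmbedding r] with x h hq hr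
  rw [← hq, ← hr]
  exact h

/-! ### Divergence-free fields -/

theorem isDivFree_iff {u : VL2} :
    IsDivFree u ↔ ∀ φ, ∑ i, inner ℝ (u i) (testToL2 (testPd i φ)) = 0 := by
  have integral_eq_sum_inner (φ : testFunctions) : ∫ x, ∑ i, u i x * pd i φ x
      = ∑ i, inner ℝ (u i) (testToL2 (testPd i φ)) := by
    simp only [inner_testToL2]
    exact integral_finsetSum _ fun i _ => integrable_mul_test (u i) (testPd i φ)
  simp only [← integral_eq_sum_inner, Subtype.forall]
  rfl

theorem IsDivFree.sum_inner_gradient_eq_zero {u : VL2} (hu : IsDivFree u) (q : H1) :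
    ∑ i, inner ℝ (u i) (q.1.2 i) = 0 :=
  denseRange_testToH1.induction_on q (isClosed_eq (by fun_prop) continuous_const)
    (isDivFree_iff.1 hu)

/-- The trilinear cancellation `∫ (u · ∇ q) q = 0`: for a test function, `2 q ∇ q = ∇ (q²)`. -/
theorem IsDivFree.sum_inner_mulH1_gradient_eq_zero {U : Fin 3 → H1}
    (hU : IsDivFree fun i => (U i).1.1) (q : H1) :
    ∑ j, inner ℝ (mulH1 q (U j)) (q.1.2 j) = 0 := by
  refine denseRange_testToH1.induction_on q (isClosed_eq (by fun_prop) continuous_const)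
    fun φ => ?_
  have inner_gradient_sq (j : Fin 3) : inner ℝ (U j).1.1 (testToL2 (testPd j (φ * φ)))
      = 2 * inner ℝ (mulH1 (testToH1 φ) (U j)) (testToL2 (testPd j φ)) := by
    rw [inner_testToL2, inner_testToL2, testPd_mul, ← integral_const_mul]
    refine integral_congr_ae ?_
    filter_upwards [coeFn_mulH1 (testToH1 φ) (U j), coeFn_testToL2 φ] with x hmul hφ
    have hmul' : mulH1 (testToH1 φ) (U j) x = (φ : E3 → ℝ) x * (U j).1.1 x :=
      hmul.trans (congrArg (· * _) hφ)
    rw [hmul']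
    change _ * ((φ : E3 → ℝ) x * pd j φ x + (φ : E3 → ℝ) x * pd j φ x) = 2 * (_ * pd j φ x)
    ring
  have h := isDivFree_iff.1 hU (φ * φ)
  simp only [inner_gradient_sq, ← Finset.mul_sum] at h
  exact (mul_eq_zero.1 h).resolve_left two_ne_zero

/-! ### The Helmholtz operator and the filtered divergence -/

/-- The Helmholtz operator `1 - α² Δ` on test functions. -/
def testHelmholtz (α : ℝ) : testFunctions →ₗ[ℝ] testFunctions := LinearMap.id - α ^ 2 • testLap

theorem coe_testHelmholtz (α : ℝ) (φ : testFunctions) :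
    (testHelmholtz α φ : E3 → ℝ) = fun x => (φ : E3 → ℝ) x - α ^ 2 * lap φ x :=
  congrArg (fun χ : E3 → ℝ => fun x => (φ : E3 → ℝ) x - α ^ 2 * χ x) (coe_testLap φ)

theorem testToL2_testHelmholtz (α : ℝ) (φ : testFunctions) : testToL2 (testHelmholtz α φ)
    = testToL2 φ - α ^ 2 • ∑ j, testToL2 (testPd j (testPd j φ)) := by
  simp only [testHelmholtz, LinearMap.sub_apply, LinearMap.id_apply, LinearMap.smul_apply,
    testLap_apply, map_sub, map_smul, map_sum]

theorem testPd_testHelmholtz (α : ℝ) (j : Fin 3) (φ : testFunctions) :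
    testPd j (testHelmholtz α φ) = testHelmholtz α (testPd j φ) := by
  simp only [testHelmholtz, LinearMap.sub_apply, LinearMap.id_apply, LinearMap.smul_apply,
    map_sub, map_smul, testLap_testPd]

theorem testHelmholtz_testTranslate (α : ℝ) (z : E3) (φ : testFunctions) :
    testHelmholtz α (testTranslate z φ) = testTranslate z (testHelmholtz α φ) := by
  refine Subtype.ext ?_
  have htranslate : lap (testTranslate z φ) = fun x => lap φ (x - z) := by
    ext x
    simp only [lap, testTranslate, pd_comp_sub_right]
  rw [coe_testHelmholtz, htranslate]
  change _ = fun x => (testHelmholtz α φ : E3 → ℝ) (x - z)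
  rw [coe_testHelmholtz]
  rfl

theorem inner_sub_laplacian {g h : L2} {d d' e : Fin 3 → L2} (α : ℝ)
    (hg : ∀ j, HasWeakPartial j g (d' j)) (hd : ∀ j, HasWeakPartial j (d j) (e j)) :
    inner ℝ g (h - α ^ 2 • ∑ j, e j) = inner ℝ g h + α ^ 2 * ∑ j, inner ℝ (d' j) (d j) := by
  simp only [inner_sub_right, real_inner_smul_right, inner_sum, (hg _).inner_eq_neg_inner (hd _),
    Finset.sum_neg_distrib]
  ring

theorem inner_testHelmholtz_left {g : L2} {d e : Fin 3 → L2} (α : ℝ)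
    (hg : ∀ j, HasWeakPartial j g (d j)) (hd : ∀ j, HasWeakPartial j (d j) (e j))
    (φ : testFunctions) : inner ℝ g (testToL2 (testHelmholtz α φ))
      = inner ℝ (g - α ^ 2 • ∑ j, e j) (testToL2 φ) := by
  simp only [testToL2_testHelmholtz, inner_sub_right, inner_sub_left, real_inner_smul_right,
    real_inner_smul_left, inner_sum, sum_inner, hasWeakPartial_iff.1 (hg _),
    hasWeakPartial_iff.1 (hd _), neg_neg]

theorem norm_testPd_le_testHelmholtz {α : ℝ} (hα : 0 < α) (j : Fin 3) (φ : testFunctions) :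
    ‖testToL2 (testPd j φ)‖ ≤ α⁻¹ * ‖testToL2 (testHelmholtz α φ)‖ := by
  have green := inner_sub_laplacian (h := testToL2 φ) α (hasWeakPartial_testToL2 · φ)
    (fun k => hasWeakPartial_testToL2 k (testPd k φ))
  simp only [← testToL2_testHelmholtz, real_inner_self_eq_norm_sq] at green
  have cauchy_schwarz := real_inner_le_norm (testToL2 φ) (testToL2 (testHelmholtz α φ))
  have hj : ‖testToL2 (testPd j φ)‖ ^ 2 ≤ ∑ k, ‖testToL2 (testPd k φ)‖ ^ 2 :=
    Finset.single_le_sum (f := fun k => ‖testToL2 (testPd k φ)‖ ^ 2) (fun _ _ => sq_nonneg _)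
      (Finset.mem_univ j)
  have hsq : (α * ‖testToL2 (testPd j φ)‖) ^ 2 ≤ ‖testToL2 (testHelmholtz α φ)‖ ^ 2 := by
    have := mul_le_mul_of_nonneg_left hj (sq_nonneg α)
    nlinarith [sq_nonneg (‖testToL2 φ‖ - ‖testToL2 (testHelmholtz α φ)‖ / 2),
      sq_nonneg ‖testToL2 (testHelmholtz α φ)‖]
  rw [inv_mul_eq_div, le_div_iff₀ hα, mul_comm]
  exact le_of_sq_le_sq hsq (norm_nonneg _)

theorem testMollify_eq_zero_of_inner_testHelmholtz {α : ℝ} {g : L2}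
    (hg : ∀ φ, inner ℝ g (testToL2 (testHelmholtz α φ)) = 0) (k : testFunctions) :
    testMollify k g = 0 := by
  have hd (j : Fin 3) := hasWeakPartial_testMollify j k g
  have he (j : Fin 3) := hasWeakPartial_testMollify j (testPd j k) g
  have hzero : testMollify k g - α ^ 2 • ∑ j, testMollify (testPd j (testPd j k)) g = 0 := by
    refine denseRange_testToL2.eq_of_inner_left ℝ fun φ => ?_
    rw [← inner_testHelmholtz_left α hd he, inner_zero_left, testMollify, inner_mollify_left]
    simp only [inner_translate_left, translate_testToL2, ← testHelmholtz_testTranslate, hg,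
      mul_zero, integral_zero]
  have green := inner_sub_laplacian (h := testMollify k g) α hd he
  simp only [hzero, inner_zero_right, real_inner_self_eq_norm_sq] at green
  have : 0 ≤ α ^ 2 * ∑ j, ‖testMollify (testPd j k) g‖ ^ 2 := by positivity
  exact norm_eq_zero.1 (pow_eq_zero_iff two_ne_zero |>.1
    (by nlinarith [sq_nonneg ‖testMollify k g‖]))

theorem denseRange_testToL2_testHelmholtz (α : ℝ) :
    DenseRange (testToL2 ∘ₗ testHelmholtz α) := by
  change Dense (range (testToL2 ∘ₗ testHelmholtz α))
  rw [← LinearMap.coe_range, Submodule.dense_iff_topologicalClosure_eq_top,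
    Submodule.topologicalClosure_eq_top_iff, Submodule.eq_bot_iff]
  intro g hg
  have hsmooth (n : ℕ) : smooth n g = 0 := testMollify_eq_zero_of_inner_testHelmholtz (α := α)
    (fun φ => (Submodule.mem_orthogonal' _ _).1 hg _ ⟨φ, rfl⟩) _
  have hlim := tendsto_smooth g
  simp only [hsmooth] at hlim
  exact (tendsto_nhds_unique tendsto_const_nhds hlim).symm

/-- The operator `-div (1 - α² Δ)⁻¹` on `L²(ℝ³)³`, as the adjoint of
`(1 - α² Δ) φ ↦ ∇ φ`. -/
def filteredDiv (α : ℝ) : (Fin 3 → L2) →L[ℝ] L2 :=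
  ∑ j, (ContinuousLinearMap.adjoint
    ((testToL2 ∘ₗ testPd j).extendOfNorm (testToL2 ∘ₗ testHelmholtz α))).comp
      (ContinuousLinearMap.proj j)

theorem inner_filteredDiv_testHelmholtz {α : ℝ} (hα : 0 < α) (q : Fin 3 → L2)
    (φ : testFunctions) : inner ℝ (filteredDiv α q) (testToL2 (testHelmholtz α φ))
      = ∑ j, inner ℝ (q j) (testToL2 (testPd j φ)) := by
  have hextend (j : Fin 3) := LinearMap.extendOfNorm_eq (f := testToL2 ∘ₗ testPd j)
    (denseRange_testToL2_testHelmholtz α) ⟨α⁻¹, norm_testPd_le_testHelmholtz hα j⟩ φ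
  simp only [LinearMap.comp_apply] at hextend
  simp only [filteredDiv, _root_.sum_apply, ContinuousLinearMap.comp_apply,
    ContinuousLinearMap.proj_apply, sum_inner, ContinuousLinearMap.adjoint_inner_left, hextend]

theorem inner_filteredDiv {α : ℝ} (hα : 0 < α) (q : Fin 3 → L2) {g : L2} {d e : Fin 3 → L2}
    (hg : ∀ j, HasWeakPartial j g (d j)) (hd : ∀ j, HasWeakPartial j (d j) (e j)) :
    inner ℝ (filteredDiv α q) (g - α ^ 2 • ∑ j, e j) = ∑ j, inner ℝ (q j) (d j) := by
  have hclosed : IsClosed {r : L2 × (Fin 3 ⊕ Fin 3 → L2) |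
      inner ℝ (filteredDiv α q) (r.1 - α ^ 2 • ∑ j, r.2 (Sum.inr j))
        = ∑ j, inner ℝ (q j) (r.2 (Sum.inl j))} :=
    isClosed_eq (continuous_const.inner (by fun_prop)) (by fun_prop)
  have hmem := mem_closure_range_of_testMollify_eq (g := g) (e := Sum.elim d e)
    (D := Sum.elim testPd fun j => testPd j ∘ₗ testPd j)
    (by rintro (j | j) k φ <;> simp [testPd_testConv_left])
    (by
      rintro (j | j) k
      · exact (hg j).testMollify_testPd k
      · exact ((hg j).testMollify_testPd _).trans ((hd j).testMollify_testPd k))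
  have hgoal := closure_minimal (by
    rintro _ ⟨φ, rfl⟩
    simpa only [mem_ofPred_eq, testToL2_testHelmholtz, Sum.elim_inl, Sum.elim_inr,
      LinearMap.comp_apply] using inner_filteredDiv_testHelmholtz hα q φ) hclosed hmem
  simpa only [mem_ofPred_eq, Sum.elim_inl, Sum.elim_inr] using hgoal

/-! ### Measurability in separable Hilbert spaces -/

section Hilbert

variable {H : Type*} [NormedAddCommGroup H] [InnerProductSpace ℝ H] [SecondCountableTopology H]

theorem countable_of_orthonormal {ι : Type*} {b : ι → H} (hb : Orthonormal ℝ b) :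
    Countable ι := by
  refine Pairwise.countable_of_isOpen_disjoint (s := fun i => Metric.ball (b i) (1 / 2))
    (fun i j hij => Metric.ball_disjoint_ball ?_) (fun i => Metric.isOpen_ball)
    fun i => ⟨b i, by simp⟩
  have hdist : ‖b i - b j‖ ^ 2 = 2 := by
    rw [@norm_sub_sq ℝ, hb.1 i, hb.1 j, hb.2 hij]
    norm_num
  rw [dist_eq_norm]
  nlinarith [norm_nonneg (b i - b j)]

theorem aestronglyMeasurable_of_inner [CompleteSpace H] {Ω : Type*} [MeasurableSpace Ω]
    {μ : Measure Ω} {f : Ω → H} {D : Set H} (hD : Dense D)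
    (h : ∀ d ∈ D, AEStronglyMeasurable (fun t => inner ℝ (f t) d) μ) :
    AEStronglyMeasurable f μ := by
  have hinner (k : H) : AEStronglyMeasurable (fun t => inner ℝ (f t) k) μ := by
    obtain ⟨d, hd, hlim⟩ := mem_closure_iff_seq_limit.1 (hD k)
    exact aestronglyMeasurable_of_tendsto_ae atTop (fun n => h (d n) (hd n))
      (Eventually.of_forall fun t => tendsto_const_nhds.inner hlim)
  obtain ⟨w, b, -⟩ := exists_hilbertBasis ℝ H
  have : Countable w := countable_of_orthonormal b.orthonormal
  refine aestronglyMeasurable_of_tendsto_ae (u := (atTop : Filter (Finset w)))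
    (f := fun s t => ∑ i ∈ s, b.repr (f t) i • b i) (fun s => ?_)
    (Eventually.of_forall fun t => b.hasSum_repr (f t))
  simp only [b.repr_apply_apply, real_inner_comm]
  exact Finset.aestronglyMeasurable_fun_sum _ fun i _ => (hinner (b i)).smul_const _

end Hilbert

/-! ### Sobolev functions and their norms -/

namespace MemSob

variable {k : ℕ} {g : L2}

theorem hasWeakPartial (h : MemSob (k + 1) g) (j : Fin 3) :
    HasWeakPartial j g (weakPartial j g) := by
  obtain ⟨d, hd, -⟩ := h j
  rwa [hd.weakPartial_eq]

theorem weakPartial (h : MemSob (k + 1) g) (j : Fin 3) : MemSob k (weakPartial j g) := by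
  obtain ⟨d, hd, hk⟩ := h j
  rwa [hd.weakPartial_eq]

theorem one_of_succ (h : MemSob (k + 1) g) : MemSob 1 g := fun j =>
  ⟨_, h.hasWeakPartial j, trivial⟩

end MemSob

theorem homSq_one (g : L2) : homSq 1 g = ∑ j, ‖weakPartial j g‖ ^ 2 := rfl

theorem homSq_two (g : L2) :
    homSq 2 g = ∑ j, ∑ k, ‖weakPartial k (weakPartial j g)‖ ^ 2 := rfl

theorem homSq_nonneg : ∀ (k : ℕ) (g : L2), 0 ≤ homSq k g
  | 0, _ => sq_nonneg _
  | k + 1, _ => Finset.sum_nonneg fun _ _ => homSq_nonneg k _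

theorem norm_weakPartial_sq_le_homSq_one (j : Fin 3) (g : L2) :
    ‖weakPartial j g‖ ^ 2 ≤ homSq 1 g :=
  Finset.single_le_sum (f := fun j => ‖weakPartial j g‖ ^ 2) (fun _ _ => sq_nonneg _)
    (Finset.mem_univ j)

theorem vhomSq_nonneg (k : ℕ) (u : VL2) : 0 ≤ vhomSq k u :=
  Finset.sum_nonneg fun _ _ => homSq_nonneg k _

theorem homSq_le_vhomSq (k : ℕ) (u : VL2) (i : Fin 3) : homSq k (u i) ≤ vhomSq k u :=
  Finset.single_le_sum (f := fun i => homSq k (u i)) (fun _ _ => homSq_nonneg k _)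
    (Finset.mem_univ i)

theorem energySq_nonneg (α : ℝ) (u : VL2) : 0 ≤ energySq α u :=
  add_nonneg (vhomSq_nonneg _ _) (mul_nonneg (sq_nonneg _) (vhomSq_nonneg _ _))

open Classical in
/-- An `H¹` function together with its weak gradient, and `0` for a function outside `H¹`. -/
def toH1 (g : L2) : H1 :=
  if h : MemSob 1 g then ⟨(g, fun j => weakPartial j g), h.hasWeakPartial⟩ else 0

theorem coe_toH1 {g : L2} (h : MemSob 1 g) :
    (toH1 g : L2 × (Fin 3 → L2)) = (g, fun j => weakPartial j g) := by
  rw [toH1, dif_pos h]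

theorem norm_toH1_sq_le (g : L2) : ‖toH1 g‖ ^ 2 ≤ homSq 0 g + homSq 1 g := by
  have h0 := homSq_nonneg 0 g
  have h1 := homSq_nonneg 1 g
  rw [← Real.le_sqrt (norm_nonneg _) (by positivity)]
  by_cases h : MemSob 1 g
  · rw [Submodule.coe_norm, coe_toH1 h, norm_prod_le_iff,
      pi_norm_le_iff_of_nonneg (Real.sqrt_nonneg _)]
    exact ⟨Real.le_sqrt_of_sq_le (le_add_of_nonneg_right h1), fun j =>
      Real.le_sqrt_of_sq_le ((norm_weakPartial_sq_le_homSq_one j g).trans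
        (le_add_of_nonneg_left h0))⟩
  · rw [toH1, dif_neg h, norm_zero]
    positivity

/-! ### The weak Laplacian -/

/-- The weak Laplacian of an `H²` function. -/
def lapL2 (g : L2) : L2 := ∑ j, weakPartial j (weakPartial j g)

theorem HasWeakPartial.eq_of_comm {j k : Fin 3} {g a b c e : L2} (ha : HasWeakPartial j g a)
    (hb : HasWeakPartial k a b) (hc : HasWeakPartial k g c) (he : HasWeakPartial j c e) :
    b = e := denseRange_testToL2.eq_of_inner_left ℝ fun φ => by
  have hab := hasWeakPartial_iff.1 ha (testPd k φ)
  have hce := hasWeakPartial_iff.1 hc (testPd j φ)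
  rw [hasWeakPartial_iff.1 hb] at hab
  rw [hasWeakPartial_iff.1 he, ← testPd_comm] at hce
  linarith

/-- For smooth functions this is integrating by parts twice, so mollify. -/
theorem inner_pure_second_derivatives {j k : Fin 3} {gj gk gjj gkk gjk : L2}
    (hjj : HasWeakPartial j gj gjj) (hkk : HasWeakPartial k gk gkk)
    (hjk : HasWeakPartial k gj gjk) (hkj : HasWeakPartial j gk gjk) :
    inner ℝ gjj gkk = ‖gjk‖ ^ 2 := by
  have smoothed (n : ℕ) : inner ℝ (smooth n gjj) (smooth n gkk) = ‖smooth n gjk‖ ^ 2 := by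
    have hjk' := hkk.testMollify (testPd j (mollifierKernel n))
    rw [hkj.testMollify_testPd] at hjk'
    have hj := (hjj.testMollify (mollifierKernel n)).inner_eq_neg_inner
      (hasWeakPartial_testMollify j (mollifierKernel n) gkk)
    have hk := (hjk.testMollify (mollifierKernel n)).inner_eq_neg_inner hjk'
    rw [← real_inner_self_eq_norm_sq]
    exact neg_injective (hj.symm.trans hk)
  have hlim := (tendsto_smooth gjj).inner (𝕜 := ℝ) (tendsto_smooth gkk)
  simp only [smoothed] at hlim
  exact tendsto_nhds_unique hlim ((tendsto_smooth gjk).norm.pow 2)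

theorem norm_lapL2_sq {g : L2} (hg : MemSob 2 g) : ‖lapL2 g‖ ^ 2 = homSq 2 g := by
  rw [homSq_two, ← real_inner_self_eq_norm_sq, lapL2, sum_inner]
  refine Finset.sum_congr rfl fun j _ => ?_
  rw [inner_sum]
  refine Finset.sum_congr rfl fun k _ => ?_
  have hjk := (hg.weakPartial j).hasWeakPartial k
  have hkj := (hg.weakPartial k).hasWeakPartial j
  rw [← (hg.hasWeakPartial j).eq_of_comm hjk (hg.hasWeakPartial k) hkj] at hkj
  exact inner_pure_second_derivatives ((hg.weakPartial j).hasWeakPartial j)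
    ((hg.weakPartial k).hasWeakPartial k) hjk hkj

theorem inner_lapL2 {g h : L2} (hg : MemSob 1 g) (hh : MemSob 2 h) :
    inner ℝ g (lapL2 h) = -∑ j, inner ℝ (weakPartial j g) (weakPartial j h) := by
  simp only [lapL2, inner_sum, ← Finset.sum_neg_distrib]
  exact Finset.sum_congr rfl fun j _ =>
    (hg.hasWeakPartial j).inner_eq_neg_inner ((hh.weakPartial j).hasWeakPartial j)

theorem inner_lapL2_testToL2 {g : L2} (hg : MemSob 2 g) (φ : testFunctions) :
    inner ℝ (lapL2 g) (testToL2 φ) = inner ℝ g (testToL2 (testLap φ)) := by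
  simp only [lapL2, testLap_apply, map_sum, sum_inner, inner_sum]
  refine Finset.sum_congr rfl fun j _ => ?_
  rw [hasWeakPartial_iff.1 (hg.hasWeakPartial j),
    hasWeakPartial_iff.1 ((hg.weakPartial j).hasWeakPartial j), neg_neg]

theorem IsDivFree.lapL2 {u : VL2} (hu : IsDivFree u) (h2 : ∀ i, MemSob 2 (u i)) :
    IsDivFree fun i => lapL2 (u i) := isDivFree_iff.2 fun φ => by
  simp only [inner_lapL2_testToL2 (h2 _), testLap_testPd]
  exact isDivFree_iff.1 hu (testLap φ)

/-! ### The time derivative prescribed by the equation -/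

/-- The inner product of `𝓗¹_α`. -/
def energyInner (α : ℝ) (f u : VL2) : ℝ :=
  ∑ i, (inner ℝ (f i) (u i) + α ^ 2 * ∑ j, inner ℝ (weakPartial j (f i)) (weakPartial j (u i)))

theorem energyInner_self (α : ℝ) (u : VL2) : energyInner α u u = energySq α u := by
  simp only [energyInner, real_inner_self_eq_norm_sq, Finset.sum_add_distrib, ← Finset.mul_sum]
  rfl

/-- Half the rate of change of `‖u‖²_{𝓗¹_α}` along the flow: viscous dissipation, damping and
the work of the force. -/
def energyPower (ν α β : ℝ) (f u : VL2) : ℝ :=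
  -ν * (vhomSq 1 u + α ^ 2 * vhomSq 2 u) - β * energySq α u + energyInner α f u

/-- The value `-div ((u ⊗ u)_α) + ν Δ u - ∇ p + f - β u` of `∂ₜ u` prescribed by the equation,
for `u ∈ H²` and `p ∈ H¹`. -/
def velocityRate (ν α β : ℝ) (f u : VL2) (p : L2) : VL2 := fun i =>
  filteredDiv α (fun j => mulH1 (toH1 (u i)) (toH1 (u j))) + ν • lapL2 (u i) - weakPartial i p
    + f i - β • u i

theorem inner_mulH1_toH1_testToL2 {g h : L2} (hg : MemSob 1 g) (hh : MemSob 1 h)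
    (φ : testFunctions) :
    inner ℝ (mulH1 (toH1 g) (toH1 h)) (testToL2 φ) = ∫ x, g x * h x * (φ : E3 → ℝ) x := by
  rw [inner_testToL2]
  refine integral_congr_ae ?_
  filter_upwards [coeFn_mulH1 (toH1 g) (toH1 h)] with x hx
  rw [hx, coe_toH1 hg, coe_toH1 hh]

theorem inner_velocityRate_testHelmholtz {ν α β : ℝ} (hα : 0 < α) {f u : VL2} {p : L2}
    (hu : ∀ i, MemSob 2 (u i)) (hp : MemSob 1 p) {i : Fin 3} {w : Fin 3 → L2}
    (hw : ∀ j, IsHelmholtzFilter α (fun x => u i x * u j x) (w j)) (φ : testFunctions) :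
    inner ℝ (velocityRate ν α β f u p i) (testToL2 (testHelmholtz α φ))
      = ∑ j, inner ℝ (w j) (testToL2 (testPd j (testHelmholtz α φ)))
        + ν * inner ℝ (u i) (testToL2 (testLap (testHelmholtz α φ)))
        + inner ℝ p (testToL2 (testPd i (testHelmholtz α φ)))
        + inner ℝ (f i) (testToL2 (testHelmholtz α φ))
        - β * inner ℝ (u i) (testToL2 (testHelmholtz α φ)) := by
  have hfilter (j : Fin 3) : inner ℝ (w j) (testToL2 (testPd j (testHelmholtz α φ)))
      = inner ℝ (mulH1 (toH1 (u i)) (toH1 (u j))) (testToL2 (testPd j φ)) := by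
    rw [inner_mulH1_toH1_testToL2 (hu i).one_of_succ (hu j).one_of_succ, testPd_testHelmholtz,
      inner_testToL2, coe_testHelmholtz]
    exact hw j _ (isTest (testPd j φ))
  simp only [velocityRate, inner_sub_left, inner_add_left, real_inner_smul_left, hfilter,
    inner_filteredDiv_testHelmholtz hα, inner_lapL2_testToL2 (hu i),
    hasWeakPartial_iff.1 (hp.hasWeakPartial i)]
  ring

/-! ### The energy balance of the prescribed time derivative -/

section Power

variable {u : VL2} (hu : ∀ i, MemSob 2 (u i))

include hu

theorem sum_inner_sub_lapL2 {g : VL2} (hg : ∀ i, MemSob 1 (g i)) (α : ℝ) :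
    ∑ i, inner ℝ (g i) (u i - α ^ 2 • lapL2 (u i)) = energyInner α g u :=
  Finset.sum_congr rfl fun i _ => by
    rw [inner_sub_right, real_inner_smul_right, inner_lapL2 (hg i) (hu i)]
    ring

theorem sum_inner_lapL2_sub_lapL2 (α : ℝ) :
    ∑ i, inner ℝ (lapL2 (u i)) (u i - α ^ 2 • lapL2 (u i))
      = -(vhomSq 1 u + α ^ 2 * vhomSq 2 u) := by
  have component (i : Fin 3) : inner ℝ (lapL2 (u i)) (u i - α ^ 2 • lapL2 (u i))
      = -(homSq 1 (u i) + α ^ 2 * homSq 2 (u i)) := by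
    rw [inner_sub_right, real_inner_smul_right, real_inner_self_eq_norm_sq, norm_lapL2_sq (hu i),
      real_inner_comm, inner_lapL2 (hu i).one_of_succ (hu i)]
    simp only [real_inner_self_eq_norm_sq, homSq_one]
    ring
  simp only [component, vhomSq, Finset.sum_neg_distrib, Finset.sum_add_distrib, Finset.mul_sum]

theorem IsDivFree.sum_inner_weakPartial_sub_lapL2 (hdiv : IsDivFree u) {p : L2} (hp : MemSob 1 p)
    (α : ℝ) : ∑ i, inner ℝ (weakPartial i p) (u i - α ^ 2 • Bardina.lapL2 (u i)) = 0 := by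
  have horth {v : VL2} (hv : IsDivFree v) : ∑ i, inner ℝ (weakPartial i p) (v i) = 0 := by
    have h := hv.sum_inner_gradient_eq_zero (toH1 p)
    simpa only [coe_toH1 hp, real_inner_comm] using h
  simp only [inner_sub_right, real_inner_smul_right, Finset.sum_sub_distrib, ← Finset.mul_sum,
    horth hdiv, horth (hdiv.lapL2 hu), mul_zero, sub_zero]

theorem IsDivFree.inner_filteredDiv_mulH1_sub_lapL2 (hdiv : IsDivFree u) {α : ℝ} (hα : 0 < α)
    (i : Fin 3) : inner ℝ (filteredDiv α fun j => mulH1 (toH1 (u i)) (toH1 (u j)))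
      (u i - α ^ 2 • Bardina.lapL2 (u i)) = 0 := by
  have hdiv' : IsDivFree fun j => (toH1 (u j)).1.1 := by
    simpa only [coe_toH1 (hu _).one_of_succ] using hdiv
  rw [Bardina.lapL2, inner_filteredDiv hα _ (hu i).hasWeakPartial
    fun j => ((hu i).weakPartial j).hasWeakPartial j]
  simpa only [coe_toH1 (hu i).one_of_succ] using
    hdiv'.sum_inner_mulH1_gradient_eq_zero (toH1 (u i))

theorem IsDivFree.sum_inner_velocityRate_sub_lapL2 (hdiv : IsDivFree u) {ν α β : ℝ} (hα : 0 < α)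
    {f : VL2} (hf : ∀ i, MemSob 1 (f i)) {p : L2} (hp : MemSob 1 p) :
    ∑ i, inner ℝ (velocityRate ν α β f u p i) (u i - α ^ 2 • Bardina.lapL2 (u i))
      = energyPower ν α β f u := by
  simp only [velocityRate, inner_add_left, inner_sub_left, real_inner_smul_left,
    Finset.sum_add_distrib, Finset.sum_sub_distrib, ← Finset.mul_sum,
    hdiv.inner_filteredDiv_mulH1_sub_lapL2 hu hα, sum_inner_lapL2_sub_lapL2 hu,
    hdiv.sum_inner_weakPartial_sub_lapL2 hu hp, sum_inner_sub_lapL2 hu hf,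
    sum_inner_sub_lapL2 hu fun i => (hu i).one_of_succ, energyInner_self, energyPower,
    Finset.sum_const_zero]
  ring

end Power

/-! ### Testing the equation at a fixed time -/

theorem integral_weak_form (ν β : ℝ) (f u : VL2) (p : L2) (i : Fin 3) (w : Fin 3 → L2)
    (χ χ' : testFunctions) :
    ∫ x, (u i x * (χ' : E3 → ℝ) x + ∑ j, w j x * pd j χ x + ν * (u i x * lap χ x)
        + p x * pd i χ x + f i x * (χ : E3 → ℝ) x - β * (u i x * (χ : E3 → ℝ) x))
      = inner ℝ (u i) (testToL2 χ') + ∑ j, inner ℝ (w j) (testToL2 (testPd j χ))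
        + ν * inner ℝ (u i) (testToL2 (testLap χ)) + inner ℝ p (testToL2 (testPd i χ))
        + inner ℝ (f i) (testToL2 χ) - β * inner ℝ (u i) (testToL2 χ) := by
  have hw (j : Fin 3) := integrable_mul_test (w j) (testPd j χ)
  have h₁ := (integrable_mul_test (u i) χ').fun_add
    (integrable_finsetSum Finset.univ fun j _ => hw j)
  have hlap := (integrable_mul_test (u i) (testLap χ)).const_mul ν
  have h₂ := h₁.fun_add hlap
  have h₃ := h₂.fun_add (integrable_mul_test p (testPd i χ))
  have h₄ := h₃.fun_add (integrable_mul_test (f i) χ)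
  simp only [inner_testToL2, ← integral_const_mul, ← integral_finsetSum _ fun j _ => hw j]
  rw [← integral_add (integrable_mul_test (u i) χ') (integrable_finsetSum _ fun j _ => hw j),
    ← integral_add h₁ hlap, ← integral_add h₂ (integrable_mul_test p (testPd i χ)),
    ← integral_add h₃ (integrable_mul_test (f i) χ),
    ← integral_sub h₄ ((integrable_mul_test (u i) χ).const_mul β)]
  simp only [coe_testPd, coe_testLap]

theorem integral_weak_form_testHelmholtz {ν α β : ℝ} (hα : 0 < α) {f u : VL2} {p : L2}
    (hu : ∀ i, MemSob 2 (u i)) (hp : MemSob 1 p) {i : Fin 3} {w : Fin 3 → L2}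
    (hw : ∀ j, IsHelmholtzFilter α (fun x => u i x * u j x) (w j)) (φ : testFunctions)
    {θ : ℝ → ℝ} (hθ : Differentiable ℝ θ) (t : ℝ) :
    let χ : ℝ × E3 → ℝ := fun y => θ y.1 * (testHelmholtz α φ : E3 → ℝ) y.2
    ∫ x, (u i x * deriv (fun s => χ (s, x)) t + ∑ j, w j x * pd j (fun y => χ (t, y)) x
        + ν * (u i x * lap (fun y => χ (t, y)) x) + p x * pd i (fun y => χ (t, y)) x
        + f i x * χ (t, x) - β * (u i x * χ (t, x)))
      = deriv θ t * inner ℝ (u i) (testToL2 (testHelmholtz α φ))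
        + θ t * inner ℝ (velocityRate ν α β f u p i) (testToL2 (testHelmholtz α φ)) := by
  intro χ
  have h := integral_weak_form ν β f u p i w (θ t • testHelmholtz α φ)
    (deriv θ t • testHelmholtz α φ)
  simp only [map_smul, real_inner_smul_right] at h
  rw [inner_velocityRate_testHelmholtz hα hu hp hw]
  have hderiv (x : E3) : deriv (fun s => χ (s, x)) t
      = ((deriv θ t • testHelmholtz α φ : testFunctions) : E3 → ℝ) x := by
    change _ = deriv θ t * (testHelmholtz α φ : E3 → ℝ) x
    exact deriv_mul_const (hθ t) ((testHelmholtz α φ : E3 → ℝ) x)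
  simp only [hderiv]
  refine h.trans ?_
  rw [← Finset.mul_sum]
  ring

/-! ### Time regularity of the prescribed derivative -/

instance fact_two_ne_top : Fact ((2 : ENNReal) ≠ ⊤) := ⟨ENNReal.ofNat_ne_top⟩

section TimeRegularity

variable {Ω : Type*} {mΩ : MeasurableSpace Ω} {μ : Measure Ω}

theorem memLp_two_of_norm_sq_le {F : Type*} [NormedAddCommGroup F] {g : Ω → F} {b : Ω → ℝ}
    (hg : AEStronglyMeasurable g μ) (hb : Integrable b μ) (h : ∀ᵐ t ∂μ, ‖g t‖ ^ 2 ≤ b t) :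
    MemLp g 2 μ := by
  refine (memLp_two_iff_integrable_sq_norm hg).2 (hb.mono' (hg.norm.pow 2) ?_)
  filter_upwards [h] with t ht
  rwa [Real.norm_of_nonneg (sq_nonneg _)]

theorem aestronglyMeasurable_pi {ι : Type*} [Finite ι] {F : ι → Type*}
    [∀ i, NormedAddCommGroup (F i)] [∀ i, NormedSpace ℝ (F i)] {g : Ω → ∀ i, F i}
    (h : ∀ i, AEStronglyMeasurable (fun t => g t i) μ) : AEStronglyMeasurable g μ := by
  classical
  have := Fintype.ofFinite ι
  have hsum : g = fun t => ∑ i, ContinuousLinearMap.single ℝ F i (g t i) :=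
    funext fun t => (Finset.univ_sum_single (g t)).symm
  rw [hsum]
  exact Finset.aestronglyMeasurable_fun_sum _ fun i _ =>
    (ContinuousLinearMap.single ℝ F i).continuous.comp_aestronglyMeasurable (h i)

theorem aestronglyMeasurable_weakPartial {g : Ω → L2} (hg : AEStronglyMeasurable g μ)
    (h : ∀ᵐ t ∂μ, MemSob 1 (g t)) (j : Fin 3) :
    AEStronglyMeasurable (fun t => weakPartial j (g t)) μ := by
  refine aestronglyMeasurable_of_inner denseRange_testToL2 ?_
  rintro _ ⟨φ, rfl⟩
  have hpair : AEStronglyMeasurable (fun t => inner ℝ (g t) (testToL2 (testPd j φ))) μ :=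
    hg.inner aestronglyMeasurable_const
  refine hpair.neg.congr ?_
  filter_upwards [h] with t ht
  simp only [Pi.neg_apply, hasWeakPartial_iff.1 (ht.hasWeakPartial j) φ, neg_neg]

theorem aestronglyMeasurable_lapL2 {g : Ω → L2} (hg : AEStronglyMeasurable g μ)
    (h : ∀ᵐ t ∂μ, MemSob 2 (g t)) : AEStronglyMeasurable (fun t => lapL2 (g t)) μ :=
  Finset.aestronglyMeasurable_fun_sum _ fun j _ =>
    aestronglyMeasurable_weakPartial
      (aestronglyMeasurable_weakPartial hg (h.mono fun _ ht => ht.one_of_succ) j)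
      (h.mono fun _ ht => ht.weakPartial j) j

theorem aestronglyMeasurable_toH1 {g : Ω → L2} (hg : AEStronglyMeasurable g μ)
    (h : ∀ᵐ t ∂μ, MemSob 1 (g t)) : AEStronglyMeasurable (fun t => toH1 (g t)) μ := by
  refine Topology.IsEmbedding.subtypeVal.aestronglyMeasurable_comp_iff.1 ?_
  refine (hg.prodMk (aestronglyMeasurable_pi (aestronglyMeasurable_weakPartial hg h))).congr ?_
  filter_upwards [h] with t ht
  exact (coe_toH1 ht).symm

theorem memLp_toH1 [IsFiniteMeasure μ] {g : Ω → L2} (hg : AEStronglyMeasurable g μ)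
    (h : ∀ᵐ t ∂μ, MemSob 1 (g t)) {M : ℝ} (hM : ∀ᵐ t ∂μ, homSq 0 (g t) + homSq 1 (g t) ≤ M)
    (q : ENNReal) : MemLp (fun t => toH1 (g t)) q μ :=
  MemLp.of_bound (aestronglyMeasurable_toH1 hg h) (√M) (hM.mono fun t ht =>
    Real.le_sqrt_of_sq_le ((norm_toH1_sq_le (g t)).trans ht))

theorem memLp_weakPartial {g : Ω → L2} (hg : AEStronglyMeasurable g μ)
    (h : ∀ᵐ t ∂μ, MemSob 1 (g t)) {b : Ω → ℝ} (hb : Integrable b μ)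
    (hgb : ∀ᵐ t ∂μ, homSq 1 (g t) ≤ b t) (j : Fin 3) :
    MemLp (fun t => weakPartial j (g t)) 2 μ :=
  memLp_two_of_norm_sq_le (aestronglyMeasurable_weakPartial hg h j) hb
    (hgb.mono fun _ ht => (norm_weakPartial_sq_le_homSq_one j _).trans ht)

theorem memLp_lapL2 {g : Ω → L2} (hg : AEStronglyMeasurable g μ) (h : ∀ᵐ t ∂μ, MemSob 2 (g t))
    {b : Ω → ℝ} (hb : Integrable b μ) (hgb : ∀ᵐ t ∂μ, homSq 2 (g t) ≤ b t) :
    MemLp (fun t => lapL2 (g t)) 2 μ := by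
  refine memLp_two_of_norm_sq_le (aestronglyMeasurable_lapL2 hg h) hb ?_
  filter_upwards [h, hgb] with t ht htb using (norm_lapL2_sq ht).trans_le htb

theorem memLp_velocityRate [IsFiniteMeasure μ] (ν α β : ℝ) (f : VL2) {u : Ω → VL2} {p : Ω → L2}
    {M : ℝ} {b : Ω → ℝ} (hu : AEStronglyMeasurable u μ) (hu₂ : ∀ᵐ t ∂μ, ∀ i, MemSob 2 (u t i))
    (huM : ∀ᵐ t ∂μ, vhomSq 0 (u t) + vhomSq 1 (u t) ≤ M)
    (hui : Integrable (fun t => vhomSq 2 (u t)) μ) (hp : AEStronglyMeasurable p μ)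
    (hp₁ : ∀ᵐ t ∂μ, MemSob 1 (p t)) (hb : Integrable b μ) (hpb : ∀ᵐ t ∂μ, homSq 1 (p t) ≤ b t)
    (i : Fin 3) : MemLp (fun t => velocityRate ν α β f (u t) (p t) i) 2 μ := by
  have hcomp (j : Fin 3) : AEStronglyMeasurable (fun t => u t j) μ :=
    (continuous_apply j).comp_aestronglyMeasurable hu
  have hmem (j : Fin 3) : ∀ᵐ t ∂μ, MemSob 2 (u t j) := hu₂.mono fun t ht => ht j
  have htoH1 (j : Fin 3) (q : ENNReal) : MemLp (fun t => toH1 (u t j)) q μ :=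
    memLp_toH1 (hcomp j) ((hmem j).mono fun t ht => ht.one_of_succ) (huM.mono fun t ht =>
      (add_le_add (homSq_le_vhomSq 0 _ j) (homSq_le_vhomSq 1 _ j)).trans ht) q
  have htransport := (filteredDiv α).comp_memLp' (memLp_pi_iff.2 fun j =>
    mulH1.memLp_of_bilin 2 (htoH1 i ⊤) (htoH1 j 2))
  have hviscous : MemLp (fun t => lapL2 (u t i)) 2 μ :=
    memLp_lapL2 (hcomp i) (hmem i) hui (Eventually.of_forall fun t => homSq_le_vhomSq 2 _ i)
  have hpressure : MemLp (fun t => weakPartial i (p t)) 2 μ := memLp_weakPartial hp hp₁ hb hpb i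
  have hdamping : MemLp (fun t => u t i) 2 μ :=
    memLp_two_of_norm_sq_le (hcomp i) (integrable_const M) (huM.mono fun t ht =>
      (homSq_le_vhomSq 0 _ i).trans ((le_add_of_nonneg_right (vhomSq_nonneg 1 _)).trans ht))
  exact (((htransport.add (hviscous.const_smul ν)).sub hpressure).add (memLp_const (f i))).sub
    (hdamping.const_smul β)

end TimeRegularity

instance isLocallyFiniteMeasure_timeMeasure : IsLocallyFiniteMeasure timeMeasure := by
  unfold timeMeasure; infer_instance

theorem eventually_atTop_eq_zero {θ : ℝ → ℝ} (hθ : HasCompactSupport θ) :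
    ∀ᶠ t in atTop, θ t = 0 := by
  rw [hasCompactSupport_iff_eventuallyEq, coclosedCompact_eq_cocompact] at hθ
  exact hθ.filter_mono atTop_le_cocompact

section Primitive

variable {E : Type*} [NormedAddCommGroup E] {G : ℝ → E}

theorem intervalIntegrable_of_locallyIntegrable (hG : LocallyIntegrable G) (s t : ℝ) :
    IntervalIntegrable G volume s t :=
  intervalIntegrable_iff.mpr
    ((hG.integrableOn_isCompact isCompact_uIcc).mono_set uIoc_subset_uIcc)

theorem locallyIntegrable_indicator_Ici (hG : ∀ T, IntegrableOn G (Icc 0 T)) :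
    LocallyIntegrable ((Ici (0 : ℝ)).indicator G) := by
  rw [locallyIntegrable_iff]
  intro K hK
  obtain ⟨R, hR⟩ := hK.isBounded.subset_closedBall 0
  rw [Real.closedBall_eq_Icc] at hR
  have hR' : K ⊆ Icc (-R) R := by simpa using hR
  refine IntegrableOn.mono_set ?_ hR'
  rw [integrableOn_indicator_iff measurableSet_Ici]
  exact (hG R).mono_set fun t ht => ⟨ht.1, ht.2.2⟩

variable [NormedSpace ℝ E]

/-- The primitive of `G` with value `a` at time `0`. -/
def primitive (a : E) (G : ℝ → E) (t : ℝ) : E := a + ∫ s in (0 : ℝ)..t, G s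

theorem primitive_zero (a : E) (G : ℝ → E) : primitive a G 0 = a := by simp [primitive]

theorem continuous_primitive (hG : LocallyIntegrable G) (a : E) : Continuous (primitive a G) :=
  continuous_const.add
    (intervalIntegral.continuous_primitive (intervalIntegrable_of_locallyIntegrable hG) 0)

theorem primitive_sub (hG : LocallyIntegrable G) (a : E) (s t : ℝ) :
    primitive a G t - primitive a G s = ∫ r in s..t, G r := by
  rw [primitive, primitive, add_sub_add_left_eq_sub,
    intervalIntegral.integral_interval_sub_left (intervalIntegrable_of_locallyIntegrable hG 0 t)
      (intervalIntegrable_of_locallyIntegrable hG 0 s)]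

theorem ae_hasDerivAt_primitive [CompleteSpace E] (hG : LocallyIntegrable G) (a : E) :
    ∀ᵐ t, HasDerivAt (primitive a G) (G t) t := by
  filter_upwards [_root_.LocallyIntegrable.ae_hasDerivAt_integral hG] with t ht
  exact (ht 0).const_add a

theorem map_primitive {F : Type*} [NormedAddCommGroup F] [NormedSpace ℝ F] [CompleteSpace E]
    [CompleteSpace F] (hG : LocallyIntegrable G) (B : E →L[ℝ] F) (a : E) (t : ℝ) :
    B (primitive a G t) = primitive (B a) (fun r => B (G r)) t := by
  rw [primitive, primitive, map_add, ContinuousLinearMap.intervalIntegral_comp_comm _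
    (intervalIntegrable_of_locallyIntegrable hG 0 t)]

theorem locallyIntegrable_map {F : Type*} [NormedAddCommGroup F] [NormedSpace ℝ F]
    {μ : Measure ℝ} (hG : LocallyIntegrable G μ) (B : E →L[ℝ] F) :
    LocallyIntegrable (fun r => B (G r)) μ := by
  intro x
  obtain ⟨U, hU, hGU⟩ := hG x
  exact ⟨U, hU, B.integrable_comp hGU⟩

theorem integral_eq_sub_of_abs_sub_le {Y Y' κ : ℝ → ℝ} {s t : ℝ}
    (hκ : IntervalIntegrable κ volume s t)
    (hY : ∀ x ∈ uIcc s t, ∀ y ∈ uIcc s t, |Y x - Y y| ≤ |∫ r in y..x, κ r|)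
    (hd : ∀ᵐ r, HasDerivAt Y (Y' r) r) : ∫ r in s..t, Y' r = Y t - Y s := by
  have hΦ := hκ.absolutelyContinuousOnInterval_intervalIntegral (c := s) left_mem_uIcc
  have hac : AbsolutelyContinuousOnInterval Y s t := by
    unfold AbsolutelyContinuousOnInterval at hΦ ⊢
    refine squeeze_zero' (Eventually.of_forall fun I => Finset.sum_nonneg fun _ _ => dist_nonneg)
      ?_ hΦ
    filter_upwards [mem_inf_of_right (mem_principal_self _)] with I hI
    refine Finset.sum_le_sum fun i hi => ?_
    obtain ⟨hl, hr⟩ := hI.1 i hi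
    rw [Real.dist_eq, Real.dist_eq, intervalIntegral.integral_interval_sub_left]
    · exact hY _ hl _ hr
    · exact hκ.mono_set (uIcc_subset_uIcc left_mem_uIcc hl)
    · exact hκ.mono_set (uIcc_subset_uIcc left_mem_uIcc hr)
  rw [← hac.integral_deriv_eq_sub]
  refine intervalIntegral.integral_congr_ae ?_
  filter_upwards [hd] with r hr _
  exact hr.deriv.symm

theorem integral_deriv_mul_primitive {g : ℝ → ℝ} (hg : LocallyIntegrable g) (a : ℝ) {θ : ℝ → ℝ}
    (hθ : ContDiff ℝ ∞ θ) (hθc : HasCompactSupport θ) :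
    ∫ t, (deriv θ t * primitive a g t + θ t * g t) ∂timeMeasure = -(θ 0 * a) := by
  obtain ⟨R, hR⟩ := (((eventually_atTop_eq_zero hθc).and (eventually_atTop_eq_zero hθc.deriv)).and
    (eventually_ge_atTop 0)).exists_forall_of_atTop
  have hθac : AbsolutelyContinuousOnInterval θ 0 R :=
    ((hθ.of_le (by simp)).contDiffOn (n := 1)).absolutelyContinuousOnInterval
  have hgac : AbsolutelyContinuousOnInterval (primitive a g) 0 R :=
    ((contDiff_const (c := a)).contDiffOn (n := 1)).absolutelyContinuousOnInterval.add
      ((intervalIntegrable_of_locallyIntegrable hg 0 R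
        ).absolutelyContinuousOnInterval_intervalIntegral left_mem_uIcc)
  calc ∫ t, (deriv θ t * primitive a g t + θ t * g t) ∂timeMeasure
      = ∫ t in (0 : ℝ)..R, (deriv θ t * primitive a g t + θ t * g t) := by
        rw [intervalIntegral.integral_of_le (hR R le_rfl).2, timeMeasure,
          integral_Ici_eq_integral_Ioi]
        refine setIntegral_eq_of_subset_of_forall_sdiff_eq_zero measurableSet_Ioi
          Ioc_subset_Ioi_self fun t ht => ?_
        have hRt : R ≤ t := le_of_not_ge fun h => ht.2 ⟨ht.1, h⟩
        rw [(hR t hRt).1.1, (hR t hRt).1.2, zero_mul, zero_mul, add_zero]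
    _ = ∫ t in (0 : ℝ)..R, (deriv θ t * primitive a g t + θ t * deriv (primitive a g) t) := by
        refine intervalIntegral.integral_congr_ae ?_
        filter_upwards [ae_hasDerivAt_primitive hg a] with t ht _
        rw [ht.deriv]
    _ = -(θ 0 * a) := by
        rw [hθac.integral_deriv_mul_eq_sub hgac, (hR R le_rfl).1.1, primitive_zero]
        ring

theorem exists_antideriv {g : ℝ → ℝ} (hg : ContDiff ℝ ∞ g) (hgc : HasCompactSupport g) :
    ∃ θ : ℝ → ℝ, ContDiff ℝ ∞ θ ∧ HasCompactSupport θ ∧ ∀ t, 0 ≤ t → deriv θ t = g t := by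
  obtain ⟨R, hR⟩ := (eventually_atTop_eq_zero hgc).exists_forall_of_atTop
  let Γ : ℝ → ℝ := fun t => ∫ s in R..t, g s
  have hΓ : ∀ t, HasDerivAt Γ (g t) t := fun t =>
    intervalIntegral.integral_hasDerivAt_right (hg.continuous.intervalIntegrable _ _)
      (hg.continuous.stronglyMeasurableAtFilter _ _) hg.continuous.continuousAt
  have hΓsmooth : ContDiff ℝ ∞ Γ := by
    rw [contDiff_infty_iff_deriv, show deriv Γ = g from funext fun t => (hΓ t).deriv]
    exact ⟨fun t => (hΓ t).differentiableAt, hg⟩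
  have hΓR : ∀ t, R ≤ t → Γ t = 0 := fun t ht =>
    intervalIntegral.integral_zero_ae (Eventually.of_forall fun s hs =>
      hR s (by rw [uIoc_of_le ht] at hs; exact hs.1.le))
  let χ : ℝ → ℝ := fun t => Real.smoothTransition (t + 2)
  refine ⟨fun t => χ t * Γ t, (Real.smoothTransition.contDiff.comp
    (contDiff_id.add contDiff_const)).mul hΓsmooth, ?_, fun t ht => ?_⟩
  · refine HasCompactSupport.intro (isCompact_Icc (a := -2) (b := R)) fun t ht => ?_
    rw [mem_Icc, not_and_or, not_le, not_le] at ht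
    rcases ht with hlt | hgt
    · exact mul_eq_zero_of_left (Real.smoothTransition.zero_of_nonpos (by linarith)) _
    · rw [hΓR t hgt.le, mul_zero]
  · have hχΓ : (fun t => χ t * Γ t) =ᶠ[𝓝 t] Γ := by
      filter_upwards [Ioi_mem_nhds (show (-1 : ℝ) < t by linarith)] with r hr
      have hχ : χ r = 1 := Real.smoothTransition.one_of_one_le (by linarith [mem_Ioi.1 hr])
      rw [hχ, one_mul]
    rw [hχΓ.deriv_eq, (hΓ t).deriv]

theorem ae_eq_zero_of_integral_deriv_smul [CompleteSpace E] {w : ℝ → E}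
    (hw : LocallyIntegrable w timeMeasure)
    (h : ∀ θ : ℝ → ℝ, ContDiff ℝ ∞ θ → HasCompactSupport θ →
      ∫ t, deriv θ t • w t ∂timeMeasure = 0) : w =ᵐ[timeMeasure] 0 := by
  rw [timeMeasure, ← restrict_Ioi_eq_restrict_Ici, EventuallyEq,
    ae_restrict_iff' measurableSet_Ioi]
  refine isOpen_Ioi.ae_eq_zero_of_integral_contDiff_smul_eq_zero
    ((locallyIntegrableOn_of_locallyIntegrable_restrict hw).mono_set Ioi_subset_Ici_self)
    fun g hg hgc hgs => ?_
  obtain ⟨θ, hθ, hθc, hθg⟩ := exists_antideriv hg hgc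
  rw [← h θ hθ hθc, timeMeasure, ← setIntegral_eq_integral_of_forall_compl_eq_zero (s := Ici 0)]
  · exact setIntegral_congr_fun measurableSet_Ici fun t ht => by rw [hθg t ht]
  · intro t ht
    rw [image_eq_zero_of_notMem_tsupport fun hts => ht (Ioi_subset_Ici_self (hgs hts)), zero_smul]

end Primitive

section HilbertPrimitive

variable {H : Type*} [NormedAddCommGroup H] [InnerProductSpace ℝ H] [CompleteSpace H] {G : ℝ → H}

theorem norm_primitive_sq_sub (hG : LocallyIntegrable G) (a : H) (s t : ℝ) :
    ‖primitive a G t‖ ^ 2 - ‖primitive a G s‖ ^ 2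
      = 2 * ∫ r in s..t, inner ℝ (primitive a G r) (G r) := by
  obtain ⟨K, hK⟩ := isCompact_uIcc.exists_bound_of_continuousOn
    (continuous_primitive hG a).continuousOn (s := uIcc s t)
  rw [← intervalIntegral.integral_const_mul]
  refine (integral_eq_sub_of_abs_sub_le (Y := fun r => ‖primitive a G r‖ ^ 2)
    (κ := fun r => 2 * K * ‖G r‖)
    ((intervalIntegrable_of_locallyIntegrable hG s t).norm.const_mul _)
    (fun x hx y hy => ?_) ?_).symm
  · have hK0 : 0 ≤ K := (norm_nonneg _).trans (hK x hx)
    have hxy : |‖primitive a G x‖ - ‖primitive a G y‖| ≤ |∫ r in y..x, ‖G r‖| :=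
      (abs_norm_sub_norm_le _ _).trans (by
        rw [primitive_sub hG]
        exact intervalIntegral.norm_integral_le_abs_integral_norm)
    rw [intervalIntegral.integral_const_mul, sq_sub_sq, abs_mul, abs_mul,
      abs_of_nonneg (by positivity : 0 ≤ 2 * K),
      abs_of_nonneg (by positivity : 0 ≤ ‖primitive a G x‖ + ‖primitive a G y‖)]
    exact mul_le_mul (by linarith [hK x hx, hK y hy]) hxy (abs_nonneg _) (by positivity)
  · filter_upwards [ae_hasDerivAt_primitive hG a] with r hr
    exact hr.norm_sq

theorem inner_primitive (hG : LocallyIntegrable G) (a x : H) (t : ℝ) :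
    inner ℝ x (primitive a G t) = primitive (inner ℝ x a) (fun r => inner ℝ x (G r)) t :=
  map_primitive hG (innerSL ℝ x) a t

theorem ae_eq_primitive_of_weak {D : Set H} (hD : Dense D) {u : ℝ → H} {u₀ : H}
    (hu : LocallyIntegrable u timeMeasure) (hG : LocallyIntegrable G)
    (h : ∀ x ∈ D, ∀ θ : ℝ → ℝ, ContDiff ℝ ∞ θ → HasCompactSupport θ →
      ∫ t, (deriv θ t * inner ℝ x (u t) + θ t * inner ℝ x (G t)) ∂timeMeasure
        + θ 0 * inner ℝ x u₀ = 0) :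
    primitive u₀ G =ᵐ[timeMeasure] u := by
  have hprim : LocallyIntegrable (primitive u₀ G) timeMeasure :=
    (continuous_primitive hG u₀).locallyIntegrable
  suffices (fun t => primitive u₀ G t - u t) =ᵐ[timeMeasure] 0 from
    this.mono fun t ht => sub_eq_zero.1 ht
  refine ae_eq_zero_of_integral_deriv_smul (hprim.sub hu) fun θ hθ hθc => ?_
  have hderiv : ∀ {w : ℝ → H}, LocallyIntegrable w timeMeasure →
      Integrable (fun t => deriv θ t • w t) timeMeasure := fun hw =>
    hw.integrable_smul_left_of_hasCompactSupport (hθ.continuous_deriv (by simp)) hθc.deriv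
  have hθG : Integrable (fun t => θ t • G t) timeMeasure :=
    (hG.mono_measure Measure.restrict_le_self).integrable_smul_left_of_hasCompactSupport
      hθ.continuous hθc
  have hinteg : ∀ x {w : ℝ → H}, LocallyIntegrable w timeMeasure →
      Integrable (fun t => deriv θ t * inner ℝ x (w t) + θ t * inner ℝ x (G t)) timeMeasure := by
    intro x w hw
    simpa only [real_inner_smul_right] using
      ((hderiv hw).const_inner x).fun_add (hθG.const_inner (𝕜 := ℝ) x)
  refine hD.eq_zero_of_inner_right ℝ fun x hx => ?_
  refine (integral_inner (hderiv (hprim.sub hu)) x).symm.trans ?_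
  have hweak_prim := integral_deriv_mul_primitive (locallyIntegrable_map hG (innerSL ℝ x))
    (inner ℝ x u₀) hθ hθc
  simp only [innerSL_apply_apply, ← inner_primitive hG] at hweak_prim
  calc ∫ t, inner ℝ x (deriv θ t • (primitive u₀ G t - u t)) ∂timeMeasure
      = ∫ t, ((deriv θ t * inner ℝ x (primitive u₀ G t) + θ t * inner ℝ x (G t))
          - (deriv θ t * inner ℝ x (u t) + θ t * inner ℝ x (G t))) ∂timeMeasure := by
        simp only [real_inner_smul_right, inner_sub_right, mul_sub, add_sub_add_right_eq_sub]
    _ = 0 := by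
        rw [integral_sub (hinteg x hprim) (hinteg x hu), hweak_prim]
        linarith [h x hx θ hθ hθc]

end HilbertPrimitive

/-! ### The evolution equation in `L²` -/

theorem hasCompactSupport_fst_mul_snd {X Y : Type*} [TopologicalSpace X] [TopologicalSpace Y]
    [R1Space X] [R1Space Y] {θ : X → ℝ} {φ : Y → ℝ} (hθ : HasCompactSupport θ)
    (hφ : HasCompactSupport φ) : HasCompactSupport fun q : X × Y => θ q.1 * φ q.2 := by
  refine HasCompactSupport.intro (hθ.isCompact.prod hφ.isCompact) fun q hq => ?_
  rw [Set.mem_prod, not_and_or] at hq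
  exact hq.elim (fun h => mul_eq_zero_of_left (image_eq_zero_of_notMem_tsupport h) _)
    fun h => mul_eq_zero_of_right _ (image_eq_zero_of_notMem_tsupport h)

theorem restrict_Icc_le_timeMeasure (T : ℝ) : volume.restrict (Icc 0 T) ≤ timeMeasure :=
  Measure.restrict_mono Icc_subset_Ici_self le_rfl

theorem ae_uIoc_of_ae_timeMeasure {P : ℝ → Prop} (h : ∀ᵐ t ∂timeMeasure, P t) {s t : ℝ}
    (hs : 0 ≤ s) (ht : 0 ≤ t) : ∀ᵐ r, r ∈ uIoc s t → P r := by
  rw [timeMeasure, ae_restrict_iff' measurableSet_Ici] at h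
  exact h.mono fun r hr hrst => hr ((le_min hs ht).trans hrst.1.le)

theorem intervalIntegrable_of_integrableOn_Icc {E : Type*} [NormedAddCommGroup E] {g : ℝ → E}
    (h : ∀ T, IntegrableOn g (Icc 0 T)) {s t : ℝ} (hs : 0 ≤ s) (ht : 0 ≤ t) :
    IntervalIntegrable g volume s t :=
  intervalIntegrable_iff.2 ((h (max s t)).mono_set fun _ hr =>
    ⟨(le_min hs ht).trans hr.1.le, hr.2⟩)

/-- The time derivative which the equation prescribes for the velocity, extended by zero to
negative times so that it is locally integrable on the whole line. -/
def velocityDeriv (ν α β : ℝ) (f : VL2) (u : ℝ → VL2) (p : ℝ → L2) : ℝ → VL2 :=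
  (Ici 0).indicator fun t => velocityRate ν α β f (u t) (p t)

/-- The continuous version of the velocity: the primitive of `velocityDeriv` that starts at the
initial datum. -/
def continuousVersion (ν α β : ℝ) (f u₀ : VL2) (u : ℝ → VL2) (p : ℝ → L2) : ℝ → VL2 :=
  primitive u₀ (velocityDeriv ν α β f u p)

theorem velocityDeriv_of_nonneg (ν α β : ℝ) (f : VL2) (u : ℝ → VL2) (p : ℝ → L2) {t : ℝ}
    (ht : 0 ≤ t) : velocityDeriv ν α β f u p t = velocityRate ν α β f (u t) (p t) :=
  indicator_of_mem (mem_Ici.2 ht) _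

section Evolution

variable {ν α β : ℝ} {f u₀ : VL2} {u : ℝ → VL2} {p : ℝ → L2}

theorem IsWeakSolution.memLp_velocityRate (hup : IsWeakSolution ν α β f u₀ u p) (T : ℝ) :
    MemLp (fun t => velocityRate ν α β f (u t) (p t)) 2 (volume.restrict (Icc 0 T)) := by
  obtain ⟨M, hM⟩ := hup.energySpace.bound
  have hT := restrict_Icc_le_timeMeasure T
  exact memLp_pi_iff.2 <| Bardina.memLp_velocityRate ν α β f
    (hup.energySpace.meas.mono_measure hT) (ae_mono hT hup.energySpace.memH2) (ae_mono hT hM)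
    (hup.energySpace.sqInt T) (hup.pressureSpace.meas.mono_measure hT)
    (ae_mono hT (hup.pressureSpace.memH3.mono fun t ht => ht.one_of_succ))
    (hup.pressureSpace.sqInt T) (Eventually.of_forall fun t =>
      Finset.single_le_sum (f := fun k => homSq k (p t)) (fun k _ => homSq_nonneg k _)
        (Finset.mem_range.2 (by norm_num)))

theorem IsWeakSolution.locallyIntegrable_velocityDeriv (hup : IsWeakSolution ν α β f u₀ u p) :
    LocallyIntegrable (velocityDeriv ν α β f u p) :=
  locallyIntegrable_indicator_Ici fun T => (hup.memLp_velocityRate T).integrable (by norm_num)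

theorem InEnergySpace.locallyIntegrable (hu : InEnergySpace u) :
    LocallyIntegrable u timeMeasure := by
  obtain ⟨M, hM⟩ := hu.bound
  refine (memLp_top_of_bound hu.meas (√M) (hM.mono fun t ht => ?_)).locallyIntegrable le_top
  refine (pi_norm_le_iff_of_nonneg (Real.sqrt_nonneg M)).2 fun i => Real.le_sqrt_of_sq_le ?_
  exact (homSq_le_vhomSq 0 (u t) i).trans
    ((le_add_of_nonneg_right (vhomSq_nonneg 1 (u t))).trans ht)

theorem IsWeakSolution.integral_testHelmholtz (hup : IsWeakSolution ν α β f u₀ u p) (hα : 0 < α)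
    (i : Fin 3) (φ : testFunctions) {θ : ℝ → ℝ} (hθ : ContDiff ℝ ∞ θ)
    (hθc : HasCompactSupport θ) :
    ∫ t, (deriv θ t * inner ℝ (testToL2 (testHelmholtz α φ)) (u t i)
        + θ t * inner ℝ (testToL2 (testHelmholtz α φ)) (velocityDeriv ν α β f u p t i))
          ∂timeMeasure
      + θ 0 * inner ℝ (testToL2 (testHelmholtz α φ)) (u₀ i) = 0 := by
  obtain ⟨w, hw, hweak⟩ := hup.equation
  have hψ := isTest (testHelmholtz α φ)
  refine Eq.trans ?_ (hweak i (fun q => θ q.1 * (testHelmholtz α φ : E3 → ℝ) q.2)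
    ((hθ.comp contDiff_fst).mul (hψ.1.comp contDiff_snd))
    (hasCompactSupport_fst_mul_snd hθc hψ.2))
  congr 1
  · refine integral_congr_ae ?_
    filter_upwards [hup.energySpace.memH2, hup.pressureSpace.memH3, hw,
      ae_restrict_mem measurableSet_Ici] with t hu₂ hp₃ hwt ht
    rw [integral_weak_form_testHelmholtz hα hu₂ hp₃.one_of_succ (hwt i) φ
      (hθ.differentiable (by simp)), velocityDeriv_of_nonneg _ _ _ _ _ _ ht, real_inner_comm,
      real_inner_comm (velocityRate ν α β f (u t) (p t) i)]
  · rw [real_inner_comm, inner_testToL2, ← integral_const_mul]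
    exact integral_congr_ae (Eventually.of_forall fun x => mul_left_comm _ _ _)

theorem IsWeakSolution.continuousVersion_ae_eq (hup : IsWeakSolution ν α β f u₀ u p)
    (hα : 0 < α) : continuousVersion ν α β f u₀ u p =ᵐ[timeMeasure] u := by
  have hG := hup.locallyIntegrable_velocityDeriv
  have hcomp (i : Fin 3) : (fun t => continuousVersion ν α β f u₀ u p t i)
      =ᵐ[timeMeasure] fun t => u t i := by
    let proj : VL2 →L[ℝ] L2 := ContinuousLinearMap.proj i
    rw [show (fun t => continuousVersion ν α β f u₀ u p t i) = primitive (u₀ i) fun t =>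
      velocityDeriv ν α β f u p t i from funext (map_primitive hG proj u₀)]
    refine ae_eq_primitive_of_weak (denseRange_testToL2_testHelmholtz α)
      (locallyIntegrable_map hup.energySpace.locallyIntegrable proj)
      (locallyIntegrable_map hG proj) ?_
    rintro _ ⟨φ, rfl⟩ θ hθ hθc
    exact hup.integral_testHelmholtz hα i φ hθ hθc
  filter_upwards [ae_all_iff.2 hcomp] with t ht
  exact funext ht

end Evolution

/-! ### The continuous version stays in the energy space -/

theorem forall_of_ae_timeMeasure {P : ℝ → Prop} (hP : IsClosed {t | P t})
    (h : ∀ᵐ t ∂timeMeasure, P t) {t : ℝ} (ht : 0 ≤ t) : P t := by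
  have hdense : Dense {t : ℝ | t ∈ Ici 0 → P t} :=
    Measure.dense_of_ae (μ := volume) ((ae_restrict_iff' measurableSet_Ici).1 h)
  have hIoi : Ioi (0 : ℝ) ⊆ {t | P t} :=
    (hdense.open_subset_closure_inter isOpen_Ioi).trans
      (closure_minimal (fun r hr => hr.2 (mem_Ici.2 hr.1.le)) hP)
  exact closure_minimal hIoi hP (closure_Ioi (0 : ℝ) ▸ ht)

theorem memSob_one_of_abs_inner_le {g : L2} {C : ℝ}
    (h : ∀ j φ, |inner ℝ g (testToL2 (testPd j φ))| ≤ C * ‖testToL2 φ‖) : MemSob 1 g := by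
  intro j
  let derivPairing : testFunctions →ₗ[ℝ] ℝ :=
    -((innerSL ℝ g).toLinearMap ∘ₗ testToL2 ∘ₗ testPd j)
  refine ⟨(InnerProductSpace.toDual ℝ L2).symm (derivPairing.extendOfNorm testToL2),
    hasWeakPartial_iff.2 fun φ => ?_, trivial⟩
  have hbound (φ : testFunctions) : ‖derivPairing φ‖ ≤ C * ‖testToL2 φ‖ :=
    (norm_neg _).trans_le (h j φ)
  rw [InnerProductSpace.toDual_symm_apply,
    LinearMap.extendOfNorm_eq denseRange_testToL2 ⟨C, hbound⟩ φ]
  exact (neg_neg _).symm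

theorem isDivFree_of_ae {v : ℝ → VL2} (hv : Continuous v)
    (h : ∀ᵐ t ∂timeMeasure, IsDivFree (v t)) {t : ℝ} (ht : 0 ≤ t) : IsDivFree (v t) := by
  refine isDivFree_iff.2 fun φ => forall_of_ae_timeMeasure
    (P := fun t => ∑ i, inner ℝ (v t i) (testToL2 (testPd i φ)) = 0)
    (isClosed_eq (by fun_prop) continuous_const) ?_ ht
  exact h.mono fun r hr => isDivFree_iff.1 hr φ

namespace InEnergySpace

variable {u v : ℝ → VL2}

theorem congr (hu : InEnergySpace u) (h : v =ᵐ[timeMeasure] u) : InEnergySpace v where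
  meas := hu.meas.congr h.symm
  memH1 := by filter_upwards [hu.memH1, h] with t ht hvu using hvu ▸ ht
  bound := by
    obtain ⟨M, hM⟩ := hu.bound
    exact ⟨M, by filter_upwards [hM, h] with t ht hvu using hvu ▸ ht⟩
  memH2 := by filter_upwards [hu.memH2, h] with t ht hvu using hvu ▸ ht
  sqInt T := (hu.sqInt T).congr <| by
    filter_upwards [ae_mono (restrict_Icc_le_timeMeasure T) h] with t ht using by rw [ht]

theorem memSob_one (hu : InEnergySpace u) (hc : Continuous u) {t : ℝ} (ht : 0 ≤ t) (i : Fin 3) :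
    MemSob 1 (u t i) := by
  obtain ⟨M, hM⟩ := hu.bound
  refine memSob_one_of_abs_inner_le (C := √M) fun j φ => forall_of_ae_timeMeasure
    (P := fun t => |inner ℝ (u t i) (testToL2 (testPd j φ))| ≤ √M * ‖testToL2 φ‖)
    (isClosed_le (by fun_prop) continuous_const) ?_ ht
  filter_upwards [hu.memH1, hM] with r hr hrM
  have hnorm : ‖weakPartial j (u r i)‖ ≤ √M := Real.le_sqrt_of_sq_le <|
    (norm_weakPartial_sq_le_homSq_one j _).trans <| (homSq_le_vhomSq 1 _ i).trans <|
      (le_add_of_nonneg_left (vhomSq_nonneg 0 _)).trans hrM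
  rw [hasWeakPartial_iff.1 ((hr i).hasWeakPartial j), abs_neg]
  exact (abs_real_inner_le_norm _ _).trans (mul_le_mul_of_nonneg_right hnorm (norm_nonneg _))

variable (hu : InEnergySpace u) (T : ℝ)

include hu

theorem aestronglyMeasurable_apply (i : Fin 3) :
    AEStronglyMeasurable (fun t => u t i) (volume.restrict (Icc 0 T)) :=
  (continuous_apply i).comp_aestronglyMeasurable
    (hu.meas.mono_measure (restrict_Icc_le_timeMeasure T))

theorem memLp_apply (i : Fin 3) : MemLp (fun t => u t i) 2 (volume.restrict (Icc 0 T)) := by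
  obtain ⟨M, hM⟩ := hu.bound
  refine memLp_two_of_norm_sq_le (hu.aestronglyMeasurable_apply T i) (integrable_const M) ?_
  filter_upwards [ae_mono (restrict_Icc_le_timeMeasure T) hM] with t ht
  exact (homSq_le_vhomSq 0 _ i).trans ((le_add_of_nonneg_right (vhomSq_nonneg 1 _)).trans ht)

theorem memLp_weakPartial (i j : Fin 3) :
    MemLp (fun t => Bardina.weakPartial j (u t i)) 2 (volume.restrict (Icc 0 T)) := by
  obtain ⟨M, hM⟩ := hu.bound
  have hT := restrict_Icc_le_timeMeasure T
  refine Bardina.memLp_weakPartial (hu.aestronglyMeasurable_apply T i)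
    (ae_mono hT (hu.memH1.mono fun _ ht => ht i)) (integrable_const M) ?_ j
  filter_upwards [ae_mono hT hM] with t ht
  exact (homSq_le_vhomSq 1 _ i).trans ((le_add_of_nonneg_left (vhomSq_nonneg 0 _)).trans ht)

theorem memLp_lapL2 (i : Fin 3) :
    MemLp (fun t => Bardina.lapL2 (u t i)) 2 (volume.restrict (Icc 0 T)) :=
  Bardina.memLp_lapL2 (hu.aestronglyMeasurable_apply T i)
    (ae_mono (restrict_Icc_le_timeMeasure T) (hu.memH2.mono fun _ ht => ht i)) (hu.sqInt T)
    (Eventually.of_forall fun _ => homSq_le_vhomSq 2 _ i)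

theorem integrableOn_vhomSq_zero : IntegrableOn (fun t => vhomSq 0 (u t)) (Icc 0 T) :=
  integrable_finsetSum _ fun i _ => (hu.memLp_apply T i).integrable_norm_pow two_ne_zero

theorem integrableOn_vhomSq_one : IntegrableOn (fun t => vhomSq 1 (u t)) (Icc 0 T) :=
  integrable_finsetSum _ fun i _ => integrable_finsetSum _ fun j _ =>
    (hu.memLp_weakPartial T i j).integrable_norm_pow two_ne_zero

theorem integrableOn_energySq (α : ℝ) : IntegrableOn (fun t => energySq α (u t)) (Icc 0 T) :=
  (hu.integrableOn_vhomSq_zero T).add ((hu.integrableOn_vhomSq_one T).const_mul _)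

theorem integrableOn_energyInner (α : ℝ) (f : VL2) :
    IntegrableOn (fun t => energyInner α f (u t)) (Icc 0 T) :=
  integrable_finsetSum _ fun i _ =>
    (((hu.memLp_apply T i).integrable one_le_two).const_inner (𝕜 := ℝ) (f i)).add <|
      (integrable_finsetSum _ fun j _ => ((hu.memLp_weakPartial T i j).integrable
        one_le_two).const_inner (𝕜 := ℝ) _).const_mul _

theorem integrableOn_energyPower (ν α β : ℝ) (f : VL2) :
    IntegrableOn (fun t => energyPower ν α β f (u t)) (Icc 0 T) :=
  ((((hu.integrableOn_vhomSq_one T).add ((hu.sqInt T).const_mul _)).const_mul _).sub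
    ((hu.integrableOn_energySq T α).const_mul _)).add (hu.integrableOn_energyInner T α f)

end InEnergySpace

/-! ### Energy balance -/

/-- The linear map sending `u` to its mollification at scale `n` together with `α` times the
gradient of that mollification; the squared norm of the image is a continuous substitute for
`energySq α` on all of `L²`. -/
def energyMap (α : ℝ) (n : ℕ) : VL2 →L[ℝ] PiLp 2 fun _ : Fin 3 × Option (Fin 3) => L2 :=
  (PiLp.continuousLinearEquiv 2 ℝ fun _ : Fin 3 × Option (Fin 3) => L2).symm.toContinuousLinearMap
    ∘L ContinuousLinearMap.pi fun k =>
      (k.2.elim (smooth n) fun j => α • testMollify (testPd j (mollifierKernel n)))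
        ∘L ContinuousLinearMap.proj k.1

section EnergyMap

variable (α : ℝ)

theorem inner_energyMap (n : ℕ) (u g : VL2) :
    inner ℝ (energyMap α n u) (energyMap α n g) = ∑ i, (inner ℝ (smooth n (u i)) (smooth n (g i))
      + α ^ 2 * ∑ j, inner ℝ (testMollify (testPd j (mollifierKernel n)) (u i))
          (testMollify (testPd j (mollifierKernel n)) (g i))) := by
  rw [PiLp.inner_apply, Fintype.sum_prod_type]
  refine Finset.sum_congr rfl fun i _ => ?_
  rw [Fintype.sum_option, Finset.mul_sum]
  refine congrArg₂ (· + ·) rfl (Finset.sum_congr rfl fun j _ => ?_)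
  change inner ℝ (α • testMollify _ (u i)) (α • testMollify _ (g i)) = _
  rw [real_inner_smul_left, real_inner_smul_right, sq, mul_assoc]

theorem tendsto_norm_energyMap_sq {u : VL2} (hu : ∀ i, MemSob 1 (u i)) :
    Tendsto (fun n => ‖energyMap α n u‖ ^ 2) atTop (𝓝 (energySq α u)) := by
  simp only [← real_inner_self_eq_norm_sq, inner_energyMap, ← energyInner_self, energyInner,
    ((hu _).hasWeakPartial _).testMollify_testPd]
  have hsmooth (g : L2) : Tendsto (fun n => inner ℝ (smooth n g) (smooth n g)) atTop
      (𝓝 (inner ℝ g g)) := (tendsto_smooth g).inner (tendsto_smooth g)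
  exact tendsto_finsetSum _ fun i _ => (hsmooth _).add
    ((tendsto_finsetSum _ fun j _ => hsmooth _).const_mul _)

theorem inner_energyMap_eq_sum_inner_smooth (n : ℕ) {u : VL2} (hu : ∀ i, MemSob 2 (u i))
    (g : VL2) : inner ℝ (energyMap α n u) (energyMap α n g)
      = ∑ i, inner ℝ (smooth n (g i)) (smooth n (u i - α ^ 2 • lapL2 (u i))) := by
  rw [inner_energyMap]
  refine Finset.sum_congr rfl fun i _ => ?_
  have integrate_by_parts (j : Fin 3) :
      inner ℝ (testMollify (testPd j (mollifierKernel n)) (u i))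
          (testMollify (testPd j (mollifierKernel n)) (g i))
        = -inner ℝ (smooth n (g i)) (smooth n (weakPartial j (weakPartial j (u i)))) := by
    rw [((hu i).hasWeakPartial j).testMollify_testPd, real_inner_comm]
    exact neg_eq_iff_eq_neg.1 ((hasWeakPartial_testMollify j _ (g i)).inner_eq_neg_inner
      ((((hu i).weakPartial j).hasWeakPartial j).testMollify _)).symm
  simp only [integrate_by_parts, Finset.sum_neg_distrib, lapL2, map_sub, map_smul, map_sum,
    inner_sub_right, real_inner_smul_right, inner_sum, real_inner_comm (smooth n (g i))]
  ring

theorem tendsto_inner_energyMap {u : VL2} (hu : ∀ i, MemSob 2 (u i)) (g : VL2) :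
    Tendsto (fun n => inner ℝ (energyMap α n u) (energyMap α n g)) atTop
      (𝓝 (∑ i, inner ℝ (g i) (u i - α ^ 2 • lapL2 (u i)))) := by
  simp only [inner_energyMap_eq_sum_inner_smooth α _ hu]
  exact tendsto_finsetSum _ fun i _ => (tendsto_smooth _).inner (tendsto_smooth _)

theorem abs_inner_energyMap_le (n : ℕ) {u : VL2} (hu : ∀ i, MemSob 2 (u i)) (g : VL2) :
    |inner ℝ (energyMap α n u) (energyMap α n g)|
      ≤ ∑ i, ‖g i‖ * ‖u i - α ^ 2 • lapL2 (u i)‖ := by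
  rw [inner_energyMap_eq_sum_inner_smooth α n hu]
  exact (Finset.abs_sum_le_sum_abs _ _).trans <| Finset.sum_le_sum fun i _ =>
    (abs_real_inner_le_norm _ _).trans <| mul_le_mul (norm_smooth_apply_le n _)
      (norm_smooth_apply_le n _) (norm_nonneg _) (norm_nonneg _)

theorem energySq_primitive_sub {G : ℝ → VL2} (hG : LocallyIntegrable G) (a : VL2) {s t : ℝ}
    (hs : ∀ i, MemSob 1 (primitive a G s i)) (ht : ∀ i, MemSob 1 (primitive a G t i))
    (hst : ∀ᵐ r, r ∈ uIoc s t → ∀ i, MemSob 2 (primitive a G r i))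
    (hinteg : IntervalIntegrable (fun r => ∑ i, ‖G r i‖
      * ‖primitive a G r i - α ^ 2 • lapL2 (primitive a G r i)‖) volume s t) :
    energySq α (primitive a G t) - energySq α (primitive a G s) = 2 * ∫ r in s..t,
      ∑ i, inner ℝ (G r i) (primitive a G r i - α ^ 2 • lapL2 (primitive a G r i)) := by
  have balance (n : ℕ) : ‖energyMap α n (primitive a G t)‖ ^ 2
      - ‖energyMap α n (primitive a G s)‖ ^ 2 = 2 * ∫ r in s..t,
        inner ℝ (energyMap α n (primitive a G r)) (energyMap α n (G r)) := by
    simpa only [map_primitive hG] using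
      norm_primitive_sq_sub (locallyIntegrable_map hG (energyMap α n)) (energyMap α n a) s t
  refine tendsto_nhds_unique ((tendsto_norm_energyMap_sq α ht).sub
    (tendsto_norm_energyMap_sq α hs)) ?_
  simp only [balance]
  refine (intervalIntegral.tendsto_integral_filter_of_dominated_convergence _
    (Eventually.of_forall fun n => ?_) (Eventually.of_forall fun n => ?_) hinteg ?_).const_mul 2
  · exact (((energyMap α n).continuous.comp (continuous_primitive hG a)).aestronglyMeasurable.inner
      ((energyMap α n).continuous.comp_aestronglyMeasurable hG.aestronglyMeasurable)).restrict
  · exact hst.mono fun r hr hrst => abs_inner_energyMap_le α n (hr hrst) (G r)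
  · exact hst.mono fun r hr hrst => tendsto_inner_energyMap α (hr hrst) (G r)

end EnergyMap

/-- The energy equality `d/dt ‖v‖²_{𝓗¹_α} = 2 * energyPower ν α β f v` on `[0, +∞)`, integrated in
time. -/
def HasEnergyBalance (ν α β : ℝ) (f : VL2) (v : ℝ → VL2) : Prop :=
  ∀ ⦃s t : ℝ⦄, 0 ≤ s → 0 ≤ t →
    energySq α (v t) - energySq α (v s) = 2 * ∫ r in s..t, energyPower ν α β f (v r)

section Balance

variable {ν α β : ℝ} {f u₀ : VL2} {u : ℝ → VL2} {p : ℝ → L2}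

theorem IsWeakSolution.continuous_continuousVersion (hup : IsWeakSolution ν α β f u₀ u p) :
    Continuous (continuousVersion ν α β f u₀ u p) :=
  continuous_primitive hup.locallyIntegrable_velocityDeriv u₀

theorem continuousVersion_zero (ν α β : ℝ) (f u₀ : VL2) (u : ℝ → VL2) (p : ℝ → L2) :
    continuousVersion ν α β f u₀ u p 0 = u₀ :=
  primitive_zero _ _

theorem IsWeakSolution.inEnergySpace_continuousVersion (hup : IsWeakSolution ν α β f u₀ u p)
    (hα : 0 < α) : InEnergySpace (continuousVersion ν α β f u₀ u p) :=
  hup.energySpace.congr (hup.continuousVersion_ae_eq hα)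

theorem IsWeakSolution.memSolenoidalH1_continuousVersion
    (hup : IsWeakSolution ν α β f u₀ u p) (hα : 0 < α) {t : ℝ} (ht : 0 ≤ t) :
    MemSolenoidalH1 (continuousVersion ν α β f u₀ u p t) := by
  refine ⟨(hup.inEnergySpace_continuousVersion hα).memSob_one hup.continuous_continuousVersion ht,
    isDivFree_of_ae hup.continuous_continuousVersion ?_ ht⟩
  filter_upwards [hup.divFree, hup.continuousVersion_ae_eq hα] with r hr hvu using hvu ▸ hr

theorem IsWeakSolution.hasEnergyBalance (hup : IsWeakSolution ν α β f u₀ u p) (hα : 0 < α)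
    (hf : ∀ i, MemSob 1 (f i)) :
    HasEnergyBalance ν α β f (continuousVersion ν α β f u₀ u p) := by
  intro s t hs ht
  have hv := hup.inEnergySpace_continuousVersion hα
  have hrate : ∀ᵐ r ∂timeMeasure, velocityDeriv ν α β f u p r
      = velocityRate ν α β f (continuousVersion ν α β f u₀ u p r) (p r) := by
    filter_upwards [hup.continuousVersion_ae_eq hα, ae_restrict_mem measurableSet_Ici] with r hr h0
    rw [hr, velocityDeriv_of_nonneg _ _ _ _ _ _ h0]
  rw [continuousVersion, energySq_primitive_sub α hup.locallyIntegrable_velocityDeriv u₀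
    (hup.memSolenoidalH1_continuousVersion hα hs).1 (hup.memSolenoidalH1_continuousVersion hα ht).1
    (ae_uIoc_of_ae_timeMeasure hv.memH2 hs ht)]
  · congr 1
    refine intervalIntegral.integral_congr_ae (ae_uIoc_of_ae_timeMeasure ?_ hs ht)
    filter_upwards [hrate, hv.memH2, hup.pressureSpace.memH3,
      ae_restrict_mem measurableSet_Ici] with r hr h2 h3 h0
    simp only [hr]
    exact (hup.memSolenoidalH1_continuousVersion hα h0).2.sum_inner_velocityRate_sub_lapL2 h2 hα hf
      h3.one_of_succ
  · refine intervalIntegrable_of_integrableOn_Icc (fun T => ?_) hs ht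
    refine integrable_finsetSum _ fun i _ => ?_
    have hG : MemLp (fun r => velocityDeriv ν α β f u p r i) 2 (volume.restrict (Icc 0 T)) :=
      (memLp_pi_iff.1 (hup.memLp_velocityRate T) i).ae_eq <| by
        filter_upwards [ae_restrict_mem measurableSet_Icc] with r hr
        rw [velocityDeriv_of_nonneg _ _ _ _ _ _ hr.1]
    exact hG.norm.integrable_mul
      ((hv.memLp_apply T i).sub ((hv.memLp_lapL2 T i).const_smul (α ^ 2))).norm

end Balance

/-! ### A priori estimates -/

theorem two_mul_inner_le {H : Type*} [NormedAddCommGroup H] [InnerProductSpace ℝ H] {β : ℝ}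
    (hβ : 0 < β) (x y : H) : 2 * inner ℝ x y ≤ β * ‖y‖ ^ 2 + ‖x‖ ^ 2 / β := by
  have hsq : 0 ≤ ‖β • y - x‖ ^ 2 / β := by positivity
  rw [norm_sub_sq_real, norm_smul, real_inner_smul_left, real_inner_comm, mul_pow,
    Real.norm_eq_abs, sq_abs] at hsq
  have hexpand : (β ^ 2 * ‖y‖ ^ 2 - 2 * (β * inner ℝ x y) + ‖x‖ ^ 2) / β
      = β * ‖y‖ ^ 2 + ‖x‖ ^ 2 / β - 2 * inner ℝ x y := by
    field_simp
    ring
  linarith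

theorem two_mul_energyInner_le {β : ℝ} (hβ : 0 < β) (α : ℝ) (f u : VL2) :
    2 * energyInner α f u ≤ β * energySq α u + energySq α f / β := by
  simp only [← energyInner_self, energyInner, Finset.mul_sum, Finset.sum_div,
    ← Finset.sum_add_distrib, mul_add, add_div, real_inner_self_eq_norm_sq]
  refine Finset.sum_le_sum fun i _ => ?_
  have hgrad := Finset.sum_le_sum fun j (_ : j ∈ Finset.univ) => mul_le_mul_of_nonneg_left
    (two_mul_inner_le hβ (weakPartial j (f i)) (weakPartial j (u i))) (sq_nonneg α)
  have hfun := two_mul_inner_le hβ (f i) (u i)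
  simp only [mul_add, Finset.sum_add_distrib] at hgrad
  simp only [mul_div_assoc, mul_left_comm β, mul_left_comm (2 : ℝ)] at *
  linarith

theorem le_exp_of_integral_le {y : ℝ → ℝ} {β K : ℝ} (hβ : β ≠ 0) (hy : ContinuousOn y (Ici 0))
    (h : ∀ s t, 0 ≤ s → s ≤ t → y t + β * ∫ r in s..t, y r ≤ y s + K * (t - s)) {t : ℝ}
    (ht : 0 ≤ t) : y t ≤ y 0 * Real.exp (-β * t) + K / β * (1 - Real.exp (-β * t)) := by
  have hgronwall := le_gronwallBound_of_liminf_deriv_right_le (f' := fun x => -β * y x + K)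
    (K := -β) (ε := K) (hy.mono Icc_subset_Ici_self) ?_ le_rfl (fun _ _ => le_rfl) t ⟨ht, le_rfl⟩
  · rw [gronwallBound_of_K_ne_0 (neg_ne_zero.2 hβ), sub_zero] at hgronwall
    refine hgronwall.trans_eq ?_
    rw [div_neg]
    ring
  · intro x hx r hr
    have hyx : ContinuousOn y (Ici x) := hy.mono (Ici_subset_Ici.2 hx.1)
    have hderiv : HasDerivWithinAt (fun z => -β * (∫ s in x..z, y s) + K * (z - x))
        (-β * y x + K) (Ioi x) x := by
      have hprim : HasDerivWithinAt (fun z => ∫ s in x..z, y s) (y x) (Ioi x) x :=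
        (intervalIntegral.integral_hasDerivWithinAt_right (s := Ici x) (t := Ioi x)
          IntervalIntegrable.refl
          ((hyx.mono Ioi_subset_Ici_self).stronglyMeasurableAtFilter_nhdsWithin measurableSet_Ioi x)
          ((hyx x self_mem_Ici).mono Ioi_subset_Ici_self)).mono Ioi_subset_Ici_self
      exact (mul_one K ▸ (hprim.const_mul (-β)).add
        (((hasDerivWithinAt_id x (Ioi x)).sub_const x).const_mul K) :)
    refine Eventually.frequently ?_
    filter_upwards [((hasDerivWithinAt_iff_tendsto_slope' self_notMem_Ioi).1 hderiv).eventually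
      (gt_mem_nhds hr), self_mem_nhdsWithin] with z hz hxz
    refine lt_of_le_of_lt ?_ hz
    rw [slope_def_field, intervalIntegral.integral_same, inv_mul_eq_div]
    refine div_le_div_of_nonneg_right ?_ (sub_pos.2 hxz).le
    linarith [h x z hx.1 (le_of_lt hxz)]

section EnergyBalance

variable {ν α β : ℝ} {f : VL2} {v : ℝ → VL2} (hv : InEnergySpace v)

include hv

theorem InEnergySpace.intervalIntegrable_vhomSq_one {s t : ℝ} (hs : 0 ≤ s) (ht : 0 ≤ t) :
    IntervalIntegrable (fun r => vhomSq 1 (v r)) volume s t :=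
  intervalIntegrable_of_integrableOn_Icc hv.integrableOn_vhomSq_one hs ht

theorem InEnergySpace.intervalIntegrable_vhomSq_two {s t : ℝ} (hs : 0 ≤ s) (ht : 0 ≤ t) :
    IntervalIntegrable (fun r => vhomSq 2 (v r)) volume s t :=
  intervalIntegrable_of_integrableOn_Icc hv.sqInt hs ht

variable (hbal : HasEnergyBalance ν α β f v)

include hbal

namespace HasEnergyBalance

theorem continuousOn_energySq : ContinuousOn (fun t => energySq α (v t)) (Ici 0) := by
  have hpower := locallyIntegrable_indicator_Ici (hv.integrableOn_energyPower · ν α β f)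
  have hcont : Continuous fun t => 2 * primitive (0 : ℝ)
      ((Ici 0).indicator fun r => energyPower ν α β f (v r)) t + energySq α (v 0) :=
    ((continuous_primitive hpower 0).const_mul 2).add_const _
  refine hcont.continuousOn.congr fun t ht => ?_
  rw [← sub_eq_iff_eq_add, hbal le_rfl ht, primitive, zero_add]
  refine congrArg (2 * ·) (intervalIntegral.integral_congr fun r hr => ?_)
  rw [uIcc_of_le ht] at hr
  exact (indicator_of_mem (mem_Ici.2 hr.1) fun r => energyPower ν α β f (v r)).symm

theorem energy_inequality (hβ : 0 < β) {s t : ℝ} (hs : 0 ≤ s) (hst : s ≤ t) :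
    energySq α (v t) + β * (∫ r in s..t, energySq α (v r))
        + 2 * ν * ((∫ r in s..t, vhomSq 1 (v r)) + α ^ 2 * ∫ r in s..t, vhomSq 2 (v r))
      ≤ energySq α (v s) + energySq α f / β * (t - s) := by
  have ht := hs.trans hst
  have h1 := hv.intervalIntegrable_vhomSq_one hs ht
  have h2 := (hv.intervalIntegrable_vhomSq_two hs ht).const_mul (α ^ 2)
  have hD := (h1.add h2).const_mul (2 * ν)
  have hE := (intervalIntegrable_of_integrableOn_Icc
    (hv.integrableOn_energySq · α) hs ht).const_mul β
  have hP := (intervalIntegrable_of_integrableOn_Icc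
    (hv.integrableOn_energyPower · ν α β f) hs ht).const_mul 2
  have young_integrated : (∫ r in s..t, (2 * energyPower ν α β f (v r)
      + (β * energySq α (v r) + 2 * ν * (vhomSq 1 (v r) + α ^ 2 * vhomSq 2 (v r)))))
        ≤ ∫ _ in s..t, energySq α f / β := by
    refine intervalIntegral.integral_mono_on hst (hP.add (hE.add hD)) intervalIntegrable_const
      fun r _ => ?_
    rw [energyPower]
    linarith [two_mul_energyInner_le hβ α f (v r)]
  rw [intervalIntegral.integral_add hP (hE.add hD), intervalIntegral.integral_add hE hD]
    at young_integrated
  simp only [intervalIntegral.integral_const_mul, intervalIntegral.integral_add h1 h2,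
    intervalIntegral.integral_const, smul_eq_mul] at young_integrated
  linarith [hbal hs ht]

theorem energySq_le (hν : 0 ≤ ν) (hβ : 0 < β) {t : ℝ} (ht : 0 ≤ t) :
    energySq α (v t) ≤ energySq α (v 0) * Real.exp (-β * t)
      + energySq α f / β / β * (1 - Real.exp (-β * t)) := by
  refine le_exp_of_integral_le hβ.ne' (hbal.continuousOn_energySq hv) (fun s t hs hst => ?_) ht
  have h1 : 0 ≤ ∫ r in s..t, vhomSq 1 (v r) :=
    intervalIntegral.integral_nonneg hst fun r _ => vhomSq_nonneg 1 (v r)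
  have h2 : 0 ≤ ∫ r in s..t, vhomSq 2 (v r) :=
    intervalIntegral.integral_nonneg hst fun r _ => vhomSq_nonneg 2 (v r)
  have hdissipation := mul_nonneg hν (add_nonneg h1 (mul_nonneg (sq_nonneg α) h2))
  linarith [hbal.energy_inequality hv hβ hs hst]

theorem dissipation_le (hν : 0 ≤ ν) (hβ : 0 < β) {c : ℝ} (hc : c ≤ 2 * ν) {s t : ℝ} (hs : 0 ≤ s)
    (hst : s ≤ t) :
    ν * (∫ r in s..t, vhomSq 1 (v r)) + c * (α ^ 2 * ∫ r in s..t, vhomSq 2 (v r))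
      ≤ energySq α f / β * (t - s) + energySq α (v s) := by
  have h1 : 0 ≤ ∫ r in s..t, vhomSq 1 (v r) :=
    intervalIntegral.integral_nonneg hst fun r _ => vhomSq_nonneg 1 (v r)
  have h2 : 0 ≤ ∫ r in s..t, vhomSq 2 (v r) :=
    intervalIntegral.integral_nonneg hst fun r _ => vhomSq_nonneg 2 (v r)
  have hE : 0 ≤ ∫ r in s..t, energySq α (v r) :=
    intervalIntegral.integral_nonneg hst fun r _ => energySq_nonneg α (v r)
  linarith [hbal.energy_inequality hv hβ hs hst, energySq_nonneg α (v t), mul_nonneg hν h1,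
    mul_nonneg hβ.le hE, mul_le_mul_of_nonneg_right hc (mul_nonneg (sq_nonneg α) h2)]

end HasEnergyBalance

end EnergyBalance

end Bardina

end

theorem mainTheorem2_general (ν α β : ℝ) (hν : 0 ≤ ν) (hα : 0 < α) (hβ : 0 < β)
    (u₀ f : Bardina.VL2)
    (hf : ∀ i, Bardina.MemSob 1 (f i))
    (u : ℝ → Bardina.VL2) (p : ℝ → Bardina.L2)
    (hup : Bardina.IsWeakSolution ν α β f u₀ u p) :
    ∃ v : ℝ → Bardina.VL2,
      Bardina.IsContinuousVersion u v ∧ v 0 = u₀ ∧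
      (∀ t : ℝ, 0 ≤ t →
        Bardina.MemSolenoidalH1 (v t) ∧
        Bardina.energySq α (v t) ≤
          Bardina.energySq α u₀ * Real.exp (-β * t)
            + 4 / β ^ 2 * Bardina.energySq α f) ∧
      (∀ t T : ℝ, 0 ≤ t → 0 ≤ T →
        IntervalIntegrable (fun s => Bardina.vhomSq 1 (v s)) volume t (t + T) ∧
        IntervalIntegrable (fun s => Bardina.vhomSq 2 (v s)) volume t (t + T) ∧
        ν * (∫ s in t..(t + T), Bardina.vhomSq 1 (v s))
            + ν * α ^ 2 * (∫ s in t..(t + T), Bardina.vhomSq 2 (v s)) ≤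
          2 * T / β * Bardina.energySq α f + Bardina.energySq α (v t) ∧
        (1 / 2 ≤ ν →
          ν * (∫ s in t..(t + T), Bardina.vhomSq 1 (v s))
              + α ^ 2 * (∫ s in t..(t + T), Bardina.vhomSq 2 (v s)) ≤
            2 * T / β * Bardina.energySq α f + Bardina.energySq α (v t))) := by
  have hv := hup.inEnergySpace_continuousVersion hα
  have hbal := hup.hasEnergyBalance hα hf
  have hF : 0 ≤ Bardina.energySq α f / β := div_nonneg (Bardina.energySq_nonneg α f) hβ.le
  refine ⟨Bardina.continuousVersion ν α β f u₀ u p,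
    ⟨hup.continuous_continuousVersion.continuousOn, hup.continuousVersion_ae_eq hα⟩,
    Bardina.continuousVersion_zero ..,
    fun t ht => ⟨hup.memSolenoidalH1_continuousVersion hα ht, ?_⟩,
    fun t T ht hT => ?_⟩
  · have decay := hbal.energySq_le hv hν hβ ht
    rw [Bardina.continuousVersion_zero] at decay
    have constant_le : Bardina.energySq α f / β / β * (1 - Real.exp (-β * t))
        ≤ 4 / β ^ 2 * Bardina.energySq α f := by
      rw [show 4 / β ^ 2 * Bardina.energySq α f = Bardina.energySq α f / β / β * 4 by field_simp]
      exact mul_le_mul_of_nonneg_left (by linarith [Real.exp_pos (-β * t)]) (div_nonneg hF hβ.le)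
    exact decay.trans (by gcongr)
  · have htT : t ≤ t + T := le_add_of_nonneg_right hT
    have dissipation {c : ℝ} (hc : c ≤ 2 * ν) := hbal.dissipation_le hv hν hβ hc ht htT
    have constant_le : Bardina.energySq α f / β * (t + T - t)
        ≤ 2 * T / β * Bardina.energySq α f := by
      rw [show 2 * T / β * Bardina.energySq α f = 2 * (Bardina.energySq α f / β * T) by ring]
      linarith [mul_nonneg hF hT]
    refine ⟨hv.intervalIntegrable_vhomSq_one ht (ht.trans htT),
      hv.intervalIntegrable_vhomSq_two ht (ht.trans htT), ?_, fun hν2 => ?_⟩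
    · linarith [dissipation (c := ν) (by linarith)]
    · linarith [dissipation (c := 1) (by linarith)]

theorem mainTheorem2 (ν α β : ℝ) (hν : 0 < ν) (hα : 0 < α) (hβ : 0 < β)
    (u₀ f : Bardina.VL2)
    (hu₀ : Bardina.MemSolenoidalH1 u₀) (hf : Bardina.MemSolenoidalH1 f)
    (u : ℝ → Bardina.VL2) (p : ℝ → Bardina.L2)
    (hup : Bardina.IsWeakSolution ν α β f u₀ u p) :
    ∃ v : ℝ → Bardina.VL2,
      Bardina.IsContinuousVersion u v ∧ v 0 = u₀ ∧
      (∀ t : ℝ, 0 ≤ t →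
        Bardina.MemSolenoidalH1 (v t) ∧
        Bardina.energySq α (v t) ≤
          Bardina.energySq α u₀ * Real.exp (-β * t)
            + 4 / β ^ 2 * Bardina.energySq α f) ∧
      (∀ t T : ℝ, 0 ≤ t → 0 ≤ T →
        IntervalIntegrable (fun s => Bardina.vhomSq 1 (v s)) volume t (t + T) ∧
        IntervalIntegrable (fun s => Bardina.vhomSq 2 (v s)) volume t (t + T) ∧
        ν * (∫ s in t..(t + T), Bardina.vhomSq 1 (v s))
            + ν * α ^ 2 * (∫ s in t..(t + T), Bardina.vhomSq 2 (v s)) ≤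
          2 * T / β * Bardina.energySq α f + Bardina.energySq α (v t) ∧
        (1 / 2 ≤ ν →
          ν * (∫ s in t..(t + T), Bardina.vhomSq 1 (v s))
              + α ^ 2 * (∫ s in t..(t + T), Bardina.vhomSq 2 (v s)) ≤
            2 * T / β * Bardina.energySq α f + Bardina.energySq α (v t))) :=
  mainTheorem2_general ν α β hν.le hα hβ u₀ f hf.1 u p hup
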